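/- **Setting.** Let $\mathcal X=(X,d)$ be a compact geodesic metric space and $\mu$ an $L$-doubling Borel probability measure on $X$: every closed ball $B_r(x)=\{y: d(x,y)\le r\}$ with $r>0$ has positive finite measure and $\mu(B_{2r}(x))\le L\,\mu(B_r(x))$. The Besicovitch constant $\beta(\mathcal X)$ is the least $\beta\in\mathbb N$ such that for all $P\subseteq X$ and $\delta>0$ there are $\beta$ countable families of pairwise disjoint closed balls of radius $\delta$ with centres in $P$ whose union covers $P$. For $n\in\mathbb N$ sample $n$ points i.i.d. from $\mu$. With $r=r(n)>0$, let $G^*$ be the random geometric graph on these points, in which two points are adjacent iff their distance is at most $r$. Let $\widehat G=\widehat G^{p,q}$ be obtained from $G^*$ by deleting each edge of $G^*$ independently with probability $p$ and inserting each non-edge of $G^*$ independently with probability $q=q(n)$. For an edge $uv$ of a graph $G$, the edge clique number $\omega_{u,v}(G)$ is the size of a largest clique of $G$ containing $u$ and $v$. For $\tau=\tau(n)>0$, the $\tau$-clique-filtered graph $\widetilde G_\tau$ has the vertices of $\widehat G$, and its edges are the edges $uv$ of $\widehat G$ with $\omega_{u,v}(\widehat G)\ge\tau$. Let $d_G$ be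 the shortest-path metric of $G$ ($\infty$ between different components); $d_1$ is a $3$-approximation of $d_2$ if $\frac13 d_2\le d_1\le 3d_2$. "With high probability" means with probability tending to $1$ as $n\to\infty$. **Assumption A** (for a constant $\rho$ and $s=s(n)$, for all large $n$): $s\ge \frac{13\ln n}{n}$ and $s\le\mu(B_{r/2}(x))\le\rho s$ for all $x\in X$. **Theorem.** There is an absolute constant $c_0\in(0,1)$, and there are constants $c_1,c_2,c_3>0$ depending only on $L$, $\beta(\mathcal X)$ and $\rho$, such that the following holds under Assumption A. 1. Let $p\in(0,c_0)$ be constant and suppose that $\tau\le\frac23\log_{1/(1-p)}(sn)$ for all large $n$. Then for all large $n$ $$c_2\Big(\frac1n\Big)^{c_3/\tau}\frac{\tau}{sn\sqrt{1-p}}=\min\Big\{c_1,\;c_2\Big(\frac1n\Big)^{c_3/\tau}\frac{\tau}{sn\sqrt{1-p}}\Big\},$$ and if $q$ is at most this quantity for all large $n$, then with high probability $d_{\widetilde G_\tau}$ is a $3$-approximation of $d_{G^*}$. 2. Let $p=0$. If, for all large $n$, $\tau<\frac{sn}{4}$ and $q\le\min\big\{c_1,\;c_2(\frac1n)^{c_3/\tau}\frac{\tau}{sn}\big\}$,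 then with high probability $d_{\widetilde G_\tau}$ is a $3$-approximation of $d_{G^*}$. -/

import Mathlib

open MeasureTheory ProbabilityTheory Filter Topology unitInterval
open scoped ENNReal

/-- A geodesic metric space: any two points are joined by a path whose length is their distance,
here parametrized by arc length. -/
def IsGeodesicSpace (X : Type*) [MetricSpace X] : Prop :=
  ∀ x y : X, ∃ γ : ℝ → X, γ 0 = x ∧ γ (dist x y) = y ∧
    ∀ t ∈ Set.Icc 0 (dist x y), ∀ t' ∈ Set.Icc 0 (dist x y), dist (γ t) (γ t') = |t - t'|

/-- `μ` is an `L`-doubling measure: closed balls of positive radius have positive finite measure,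
and `μ (B_{2r}(x)) ≤ L μ (B_r(x))` for every centre and every positive radius. -/
def IsDoublingMeasure {X : Type*} [MetricSpace X] [MeasurableSpace X]
    (μ : Measure X) (L : ℝ) : Prop :=
  ∀ (x : X) (r : ℝ), 0 < r →
    0 < μ (Metric.closedBall x r) ∧ μ (Metric.closedBall x r) < ∞ ∧
    μ (Metric.closedBall x (2 * r)) ≤ ENNReal.ofReal L * μ (Metric.closedBall x r)

/-- `C` is the set of centres of a `δ`-packing with respect to `P`: a countable family of pairwise
disjoint closed balls of radius `δ` centred in `P`. -/
def IsPacking {X : Type*} [MetricSpace X] (C P : Set X) (δ : ℝ) : Prop :=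
  C ⊆ P ∧ C.Countable ∧ C.PairwiseDisjoint (fun c => Metric.closedBall c δ)

/-- For every `P ⊆ X` and `δ > 0` there are `β` many `δ`-packings with respect to `P` whose union
covers `P`. -/
def BesicovitchCovering (X : Type*) [MetricSpace X] (β : ℕ) : Prop :=
  ∀ (P : Set X) (δ : ℝ), 0 < δ →
    ∃ C : Fin β → Set X, (∀ i, IsPacking (C i) P δ) ∧
      P ⊆ ⋃ i, ⋃ c ∈ C i, Metric.closedBall c δ

/-- The Besicovitch constant of a (doubling) space: the least admissible number of packings. -/
noncomputable def besicovitchConst (X : Type*) [MetricSpace X] : ℕ :=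
  sInf {β : ℕ | BesicovitchCovering X β}

/-- The density and regularity condition on `μ` at scale `r`, for `n` sample points. -/
def AssumptionA {X : Type*} [MetricSpace X] [MeasurableSpace X]
    (μ : Measure X) (n : ℕ) (r s ρ : ℝ) : Prop :=
  13 * Real.log n / n ≤ s ∧
    ∀ x : X, s ≤ μ.real (Metric.closedBall x (r / 2)) ∧
      μ.real (Metric.closedBall x (r / 2)) ≤ ρ * s

/-- The random geometric graph (`r`-neighborhood graph) on the sample points `x i`. -/
def geometricGraph {X V : Type*} [MetricSpace X] (r : ℝ) (x : V → X) : SimpleGraph V where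
  Adj i j := i ≠ j ∧ dist (x i) (x j) ≤ r
  symm := ⟨fun _ _ h => ⟨h.1.symm, by rw [dist_comm]; exact h.2⟩⟩
  loopless := ⟨fun _ h => h.1 rfl⟩

/-- The perturbation of `G`: an edge `e` of `G` is deleted iff `del e`, a non-edge `e` is
inserted iff `ins e`. -/
def perturbedGraph {V : Type*} (G : SimpleGraph V) (del ins : Sym2 V → Bool) :
    SimpleGraph V where
  Adj i j := i ≠ j ∧
    ((G.Adj i j ∧ del s(i, j) = false) ∨ (¬ G.Adj i j ∧ ins s(i, j) = true))
  symm := ⟨fun i j h => ⟨h.1.symm, by rw [G.adj_comm, Sym2.eq_swap]; exact h.2⟩⟩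
  loopless := ⟨fun _ h => h.1 rfl⟩

/-- The edge clique number: the size of the largest clique containing both `u` and `v`
(used only for edges `uv`). -/
noncomputable def edgeCliqueNumber {V : Type*} (G : SimpleGraph V) (u v : V) : ℕ :=
  sSup {k : ℕ | ∃ S : Finset V, u ∈ S ∧ v ∈ S ∧ G.IsNClique k S}

theorem edgeCliqueNumber_comm {V : Type*} (G : SimpleGraph V) (u v : V) :
    edgeCliqueNumber G u v = edgeCliqueNumber G v u := by
  unfold edgeCliqueNumber
  congr 1
  ext k
  constructor <;> rintro ⟨S, h1, h2, h3⟩ <;> exact ⟨S, h2, h1, h3⟩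

/-- `τ`-clique filtering: keep exactly the edges whose edge clique number is at least `τ`. -/
noncomputable def cliqueFilter {V : Type*} (G : SimpleGraph V) (τ : ℝ) : SimpleGraph V where
  Adj u v := G.Adj u v ∧ τ ≤ (edgeCliqueNumber G u v : ℝ)
  symm := ⟨fun u v h => ⟨h.1.symm, by rw [edgeCliqueNumber_comm]; exact h.2⟩⟩
  loopless := ⟨fun v h => G.loopless.irrefl v h.1⟩

/-- The shortest-path metric of `G`, with value `∞` between different components. -/
noncomputable def shortestPathDist {V : Type*} (G : SimpleGraph V) (u v : V) : ℝ≥0∞ :=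
  ENat.toENNReal (G.edist u v)

/-- `d₁` is an `α`-approximation of `d₂`: `(1/α) d₂ ≤ d₁ ≤ α d₂`. -/
def IsMetricApprox {V : Type*} (α : ℝ≥0∞) (d₁ d₂ : V → V → ℝ≥0∞) : Prop :=
  ∀ u v : V, α⁻¹ * d₂ u v ≤ d₁ u v ∧ d₁ u v ≤ α * d₂ u v

/-- A sample: the positions of `n` points, a deletion coin and an insertion coin for each pair. -/
abbrev SampleSpace (X : Type*) (n : ℕ) : Type _ :=
  (Fin n → X) × (Sym2 (Fin n) → Bool) × (Sym2 (Fin n) → Bool)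

/-- The law of the sample: `n` i.i.d. points from `μ`, and, independently, independent deletion
coins with success probability `p` and insertion coins with success probability `q`. -/
noncomputable def sampleMeasure {X : Type*} [MeasurableSpace X] (μ : Measure X) (n : ℕ)
    (p q : I) : Measure (SampleSpace X n) :=
  (Measure.pi fun _ : Fin n => μ).prod
    ((Measure.pi fun _ : Sym2 (Fin n) => bernoulliMeasure true false p).prod
      (Measure.pi fun _ : Sym2 (Fin n) => bernoulliMeasure true false q))

/-- The random geometric graph `G*` of a sample. -/
def trueGraph {X : Type*} [MetricSpace X] {n : ℕ} (r : ℝ) (ω : SampleSpace X n) :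
    SimpleGraph (Fin n) :=
  geometricGraph r ω.1

/-- The ER-perturbed random geometric graph of a sample. -/
def observedGraph {X : Type*} [MetricSpace X] {n : ℕ} (r : ℝ) (ω : SampleSpace X n) :
    SimpleGraph (Fin n) :=
  perturbedGraph (trueGraph r ω) ω.2.1 ω.2.2

/-- The event that the shortest-path metric of the `τ`-clique-filtered observed graph is a
3-approximation of the shortest-path metric of `G*`. -/
def recoveryEvent (X : Type*) [MetricSpace X] (n : ℕ) (r τ : ℝ) : Set (SampleSpace X n) :=
  {ω | IsMetricApprox 3 (shortestPathDist (cliqueFilter (observedGraph r ω) τ))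
    (shortestPathDist (trueGraph r ω))}

/-! ### Deterministic graph theory: what must fail for distances to be distorted. -/

section Deterministic

variable {V : Type*}

/-! It suffices that every edge of either graph has endpoints at distance at most 3 in the other; in
fact 2 is achieved in both directions. Write `y = s n`.

Filtered edges are short. Let `uv` be filtered and more than 2 apart in `G*`. Some observed clique
`K` of size `k = max 2 ⌈τ⌉` contains `u` and `v`, which have no common closed neighbour. If some `x
∈ K` has at least `k/2` closed neighbours in `K`, then `u` or `v` misses a quarter of `K` near `x`,
so about `k/4` insertions occurred between one vertex and one neighbourhood. Otherwise `K` contains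
at least `k²/4` inserted pairs (`edist_le_two_of_cliqueFilter_adj`). Degrees are `O(y)` by doubling
and a Chernoff bound, so a union bound excludes both cases for the given `q`
(`coin_real_insertionFailure_le`, `insertion_bound_le`).

True edges are bridged. For an edge `uv` of `G*`, the ball of radius `r/2` about a midpoint has
diameter at most `r` and contains `u` and `v`; its sample points, at least `y/4` of them with high
probability, form a clique together with `u` and `v` (`pi_real_not_edgesInCliques_le`). If `p = 0`,
this clique keeps the edge. If `p > 0`, most of these points keep both their edges to `u` and `v`,
and among them some `k`-clique `Q` survives deletion; `Q ∪ {u}` and `Q ∪ {v}` are then observed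
cliques, giving a filtered path of length 2 (`edist_cliqueFilter_le_two`).

The set where `Q` is sought depends on the coins, which costs a union bound over `4^m` subsets.
Hence the absence of a clique must have probability far below `4^{-m}`. This comes from `P²`
independent trials on pair-disjoint `k`-partite blocks, each succeeding with probability at least
1/3 by the second moment method (`coin_third_le_real_exists_transversal`, `coin_real_no_clique_le`).
For `k` near `(2/3) log_{1/(1-p)} y` blocks need parts of size only about `y^{1/3}`, so `P²` is
about `y^{4/3}` up to logarithms, which dominates `m ≈ y/8`. -/

theorem edist_le_three_mul_edist {G H : SimpleGraph V}
    (h : ∀ u v, G.Adj u v → H.edist u v ≤ 3) (u v : V) : H.edist u v ≤ 3 * G.edist u v := by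
  by_cases hr : G.edist u v = ⊤
  · rw [hr]
    simp
  · obtain ⟨w, hw⟩ := G.exists_walk_of_edist_ne_top hr
    rw [← hw]
    clear hw hr
    induction w with
    | nil => simp
    | @cons a b c hab p ih =>
      calc H.edist a c ≤ H.edist a b + H.edist b c := H.edist_triangle
        _ ≤ 3 + 3 * (p.length : ℕ∞) := add_le_add (h a b hab) ih
        _ = 3 * ((SimpleGraph.Walk.cons hab p).length : ℕ∞) := by
          rw [SimpleGraph.Walk.length_cons]; push_cast; ring

theorem isMetricApprox_three_of_adj {G H : SimpleGraph V}
    (h₁ : ∀ u v, G.Adj u v → H.edist u v ≤ 3) (h₂ : ∀ u v, H.Adj u v → G.edist u v ≤ 3) :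
    IsMetricApprox 3 (shortestPathDist H) (shortestPathDist G) := by
  intro u v
  have key : ∀ {a b : ℕ∞}, a ≤ 3 * b → ENat.toENNReal a ≤ 3 * ENat.toENNReal b := by
    intro a b hab
    have := ENat.toENNReal_le.2 hab
    rwa [ENat.toENNReal_mul, show ENat.toENNReal 3 = 3 from ENat.toENNReal_ofNat 3] at this
  constructor
  · have h := key (edist_le_three_mul_edist h₂ u v)
    rw [ENNReal.inv_mul_le_iff (by norm_num) (by norm_num)]
    exact h
  · exact key (edist_le_three_mul_edist h₁ u v)

/-- The supremum is attained because clique sizes are bounded, and a clique can be thinned while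
keeping `u` and `v`. The edge itself is a 2-clique, hence the maximum with 2 when `τ` is small. -/
theorem exists_isNClique_of_cliqueFilter_adj [Fintype V] {G : SimpleGraph V} {τ : ℝ} {u v : V}
    {k : ℕ} (h : (cliqueFilter G τ).Adj u v) (hk : 2 ≤ k) (hk' : k ≤ max 2 ⌈τ⌉₊) :
    ∃ K : Finset V, u ∈ K ∧ v ∈ K ∧ G.IsNClique k K := by
  classical
  obtain ⟨huv, hτ⟩ := h
  have hne : u ≠ v := huv.ne
  have hpair : G.IsNClique 2 {u, v} := by
    rw [SimpleGraph.isNClique_iff]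
    refine ⟨?_, Finset.card_pair hne⟩
    simp [SimpleGraph.isClique_iff, Set.pairwise_insert, huv, huv.symm]
  have hmem : edgeCliqueNumber G u v ∈
      {k : ℕ | ∃ S : Finset V, u ∈ S ∧ v ∈ S ∧ G.IsNClique k S} := by
    refine Nat.sSup_mem ⟨2, {u, v}, by simp, by simp, hpair⟩ ⟨Fintype.card V, ?_⟩
    rintro m ⟨S, -, -, hS⟩
    rw [← hS.card_eq]
    exact Finset.card_le_univ S
  have h2 : 2 ≤ edgeCliqueNumber G u v := by
    refine le_csSup ⟨Fintype.card V, ?_⟩ ⟨{u, v}, by simp, by simp, hpair⟩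
    rintro m ⟨S, -, -, hS⟩
    rw [← hS.card_eq]
    exact Finset.card_le_univ S
  obtain ⟨S, hu, hv, hS⟩ := hmem
  have hkS : k ≤ S.card := by
    rw [hS.card_eq]
    exact hk'.trans (max_le h2 (Nat.ceil_le.2 hτ))
  obtain ⟨K, hK1, hK2, hK3⟩ := Finset.exists_subsuperset_card_eq (s := {u, v}) (t := S) (n := k)
    (by intro x hx; simp at hx; rcases hx with rfl | rfl <;> assumption)
    (by rw [Finset.card_pair hne]; exact hk) hkS
  refine ⟨K, hK1 (by simp), hK1 (by simp), ?_⟩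
  rw [SimpleGraph.isNClique_iff]
  exact ⟨hS.isClique.subset (by exact_mod_cast hK2), hK3⟩

theorem cliqueFilter_adj_of_isClique [Fintype V] {G : SimpleGraph V} {τ : ℝ} {u v : V}
    {K : Finset V} (hu : u ∈ K) (hv : v ∈ K) (hne : u ≠ v) (hK : G.IsClique (K : Set V))
    (hτ : τ ≤ K.card) : (cliqueFilter G τ).Adj u v := by
  refine ⟨hK hu hv hne, hτ.trans ?_⟩
  have : K.card ≤ edgeCliqueNumber G u v := by
    refine le_csSup ⟨Fintype.card V, ?_⟩ ⟨K, hu, hv, hK, rfl⟩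
    rintro m ⟨S, -, -, hS⟩
    rw [← hS.card_eq]
    exact Finset.card_le_univ S
  exact_mod_cast this

open Classical in
/-- The closed neighborhood of `x`. -/
noncomputable def closedNbrs [Fintype V] (G : SimpleGraph V) (x : V) : Finset V :=
  Finset.univ.filter fun w => w = x ∨ G.Adj x w

open Classical in
/-- The pairs joining `z` to the vertices that lie in the closed neighborhood of `x` but not in that
of `z`. -/
noncomputable def farPairs [Fintype V] (G : SimpleGraph V) (x z : V) : Finset (Sym2 V) :=
  (closedNbrs G x \ closedNbrs G z).image fun w => s(z, w)

open Classical in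
/-- The non-edges of `G` inside `K`. -/
noncomputable def nonadjPairs (G : SimpleGraph V) (K : Finset V) : Finset (Sym2 V) :=
  ((K ×ˢ K).filter fun a => a.1 ≠ a.2 ∧ ¬ G.Adj a.1 a.2).image fun a => s(a.1, a.2)

theorem mem_closedNbrs [Fintype V] {G : SimpleGraph V} {x w : V} :
    w ∈ closedNbrs G x ↔ w = x ∨ G.Adj x w := by
  simp [closedNbrs]

theorem ins_eq_true_of_perturbedGraph_adj {G : SimpleGraph V} {del ins : Sym2 V → Bool} {a b : V}
    (h : (perturbedGraph G del ins).Adj a b) (hG : ¬ G.Adj a b) : ins s(a, b) = true := by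
  rcases h.2 with h | h
  · exact absurd h.1 hG
  · exact h.2

/-- The two hypotheses rule out the two ways a clique can join distant vertices: many insertions
from one vertex into a single neighbourhood, or quadratically many insertions inside the clique. -/
theorem edist_le_two_of_cliqueFilter_adj [Fintype V] {G : SimpleGraph V}
    {del ins : Sym2 V → Bool} {τ : ℝ} {k j : ℕ} (hk : k = max 2 ⌈τ⌉₊) (hj : 4 * j ≤ k + 3)
    (h₁ : ∀ x z, ∀ S ⊆ farPairs G x z, S.card = j → ∃ e ∈ S, ins e = false)
    (h₂ : ∀ K : Finset V, K.card = k → k * k ≤ 4 * (nonadjPairs G K).card →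
      ∃ e ∈ nonadjPairs G K, ins e = false)
    {u v : V} (huv : (cliqueFilter (perturbedGraph G del ins) τ).Adj u v) :
    G.edist u v ≤ 2 := by
  classical
  by_contra hlt
  rw [not_le] at hlt
  obtain ⟨K, hu, hv, hK⟩ := exists_isNClique_of_cliqueFilter_adj huv (by omega) hk.le
  have hadj : ∀ {a b}, a ∈ K → b ∈ K → a ≠ b → (perturbedGraph G del ins).Adj a b :=
    fun ha hb hab => hK.isClique ha hb hab
  have hle1 : ∀ {x w}, w ∈ closedNbrs G x → G.edist x w ≤ 1 := by
    intro x w h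
    rw [mem_closedNbrs] at h
    rw [SimpleGraph.edist_le_one_iff_adj_or_eq]
    rcases h with h | h
    · exact Or.inr h.symm
    · exact Or.inl h
  have hmiss : ∀ w, w ∉ closedNbrs G u ∨ w ∉ closedNbrs G v := by
    intro w
    by_contra! h
    refine hlt.not_ge ?_
    calc G.edist u v ≤ G.edist u w + G.edist w v := G.edist_triangle
      _ ≤ 1 + 1 := add_le_add (hle1 h.1) (by rw [SimpleGraph.edist_comm]; exact hle1 h.2)
      _ = 2 := by norm_num
  have far : ∀ x z, z ∈ K → ((K ∩ closedNbrs G x) \ closedNbrs G z).card < j := by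
    intro x z hz
    by_contra! hc
    obtain ⟨T, hT, hTc⟩ := Finset.exists_subset_card_eq hc
    obtain ⟨e, he, he'⟩ := h₁ x z (T.image fun w => s(z, w))
      (by
        refine Finset.image_subset_image fun w hw => ?_
        have := hT hw
        simp only [Finset.mem_sdiff, Finset.mem_inter] at this ⊢
        exact ⟨this.1.2, this.2⟩)
      (by rw [Finset.card_image_of_injective _ (fun a b h => Sym2.congr_right.1 h), hTc])
    obtain ⟨w, hw, rfl⟩ := Finset.mem_image.1 he
    have hw' := hT hw
    simp only [Finset.mem_sdiff, Finset.mem_inter, mem_closedNbrs, not_or] at hw'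
    have := ins_eq_true_of_perturbedGraph_adj (hadj hz hw'.1.1 (Ne.symm hw'.2.1)) hw'.2.2
    simp [this] at he'
  -- Either `K` concentrates in one true neighbourhood, or it is sparse in `G` at every vertex.
  by_cases hdense : ∃ x ∈ K, k ≤ 2 * (K ∩ closedNbrs G x).card
  · obtain ⟨x, hx, hxk⟩ := hdense
    have hcover : K ∩ closedNbrs G x ⊆
        ((K ∩ closedNbrs G x) \ closedNbrs G u) ∪ ((K ∩ closedNbrs G x) \ closedNbrs G v) := by
      intro w hw
      rcases hmiss w with h | h
      · exact Finset.mem_union_left _ (Finset.mem_sdiff.2 ⟨hw, h⟩)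
      · exact Finset.mem_union_right _ (Finset.mem_sdiff.2 ⟨hw, h⟩)
    -- Each of the two pieces has at most `j - 1` elements, and `4 * j ≤ k + 3` makes `2 * (2 * j -
    -- 2) < k`; so `j = ⌈k/4⌉` is the largest admissible value.
    have := (Finset.card_le_card hcover).trans (Finset.card_union_le _ _)
    have := far x u hu
    have := far x v hv
    omega
  · push Not at hdense
    have hcard : k * k ≤ 4 * (nonadjPairs G K).card := by
      -- Ordered non-adjacent pairs: more than `k/2` per vertex of `K`, and at most two for each
      -- unordered pair.
      set F := (K ×ˢ K).filter fun a => a.1 ≠ a.2 ∧ ¬ G.Adj a.1 a.2 with hF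
      have hF2 : F.card ≤ 2 * (nonadjPairs G K).card := by
        rw [nonadjPairs]
        refine Finset.card_le_mul_card_image F 2 ?_
        intro e he
        induction e with
        | _ a b =>
        refine (Finset.card_le_card (t := {(a, b), (b, a)}) ?_).trans Finset.card_le_two
        rintro ⟨c, d⟩ hcd
        simp only [Finset.mem_filter, Sym2.eq_iff] at hcd
        simp only [Finset.mem_insert, Finset.mem_singleton, Prod.mk.injEq]
        exact hcd.2
      have hFsum : F.card = ∑ x ∈ K, (K \ closedNbrs G x).card := by
        rw [← Finset.card_sigma]
        refine Finset.card_bij' (fun a _ => ⟨a.1, a.2⟩) (fun a _ => (a.1, a.2)) ?_ ?_ ?_ ?_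
        · rintro ⟨a, b⟩ h
          simp only [hF, Finset.mem_filter, Finset.mem_product] at h
          simp only [Finset.mem_sigma, Finset.mem_sdiff, mem_closedNbrs, not_or]
          exact ⟨h.1.1, h.1.2, Ne.symm h.2.1, h.2.2⟩
        · rintro ⟨a, b⟩ h
          simp only [Finset.mem_sigma, Finset.mem_sdiff, mem_closedNbrs, not_or] at h
          simp only [hF, Finset.mem_filter, Finset.mem_product]
          exact ⟨⟨h.1, h.2.1⟩, Ne.symm h.2.2.1, h.2.2.2⟩
        · intros; rfl
        · intros; rfl
      have hsum : k * k ≤ 2 * F.card := by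
        rw [hFsum, Finset.mul_sum]
        calc k * k = ∑ x ∈ K, k := by rw [Finset.sum_const, hK.card_eq, smul_eq_mul]
          _ ≤ _ := Finset.sum_le_sum fun x hx => by
            have h1 := hdense x hx
            have h2 := Finset.card_sdiff_add_card_inter K (closedNbrs G x)
            rw [hK.card_eq] at h2
            omega
      omega
    obtain ⟨e, he, he'⟩ := h₂ K hK.card_eq hcard
    obtain ⟨⟨a, b⟩, hab, rfl⟩ := Finset.mem_image.1 he
    simp only [Finset.mem_filter, Finset.mem_product] at hab
    have := ins_eq_true_of_perturbedGraph_adj (hadj hab.1.1 hab.1.2 hab.2.1) hab.2.2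
    simp [this] at he'

theorem cliqueFilter_perturbedGraph_adj_of_isClique [Fintype V] {G : SimpleGraph V}
    {del ins : Sym2 V → Bool} {τ : ℝ} {u v : V} {K : Finset V} (hu : u ∈ K) (hv : v ∈ K)
    (hne : u ≠ v) (hK : G.IsClique (K : Set V)) (hτ : τ ≤ K.card)
    (hdel : ∀ a ∈ K, ∀ b ∈ K, a ≠ b → del s(a, b) = false) :
    (cliqueFilter (perturbedGraph G del ins) τ).Adj u v :=
  cliqueFilter_adj_of_isClique hu hv hne
    (fun a ha b hb hab => ⟨hab, Or.inl ⟨hK ha hb hab, hdel a ha b hb hab⟩⟩) hτ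

open Classical in
/-- The pairs joining `u` or `v` to `U`. -/
noncomputable def spokePairs (u v : V) (U : Finset V) : Finset (Sym2 V) :=
  U.image (fun w => s(u, w)) ∪ U.image (fun w => s(v, w))

/-- The set of vertices keeping both spokes has size at least `m`, but it depends on the coins;
hence a surviving clique is demanded in every `m`-subset of `U`. Any vertex of that clique is the
middle of the path. -/
theorem edist_cliqueFilter_le_two [Fintype V] [DecidableEq V] {G : SimpleGraph V}
    {del ins : Sym2 V → Bool} {τ : ℝ} {u v : V} {U : Finset V} {m k : ℕ}
    (hu : u ∉ U) (hv : v ∉ U)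
    (hU : G.IsClique (insert u (insert v U) : Finset V)) (hUm : U.card = 2 * m)
    (hk : 1 ≤ k) (hτ : τ ≤ k)
    (h₁ : ∀ S ⊆ spokePairs u v U, S.card = m → ∃ e ∈ S, del e = false)
    (h₂ : ∀ W ⊆ U, W.card = m → ∃ Q ⊆ W, Q.card = k ∧
      ∀ a ∈ Q, ∀ b ∈ Q, a ≠ b → del s(a, b) = false) :
    (cliqueFilter (perturbedGraph G del ins) τ).edist u v ≤ 2 := by
  classical
  set W := U.filter fun w => del s(u, w) = false ∧ del s(v, w) = false with hW
  have hWc : m ≤ W.card := by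
    by_contra! hlt
    have hc : m ≤ (U \ W).card := by
      have := Finset.card_sdiff_add_card_eq_card (s := W) (t := U) (Finset.filter_subset _ U)
      omega
    obtain ⟨Z, hZ, hZc⟩ := Finset.exists_subset_card_eq hc
    -- One deleted spoke for each bad vertex. The choice is injective because `u` and `v` lie
    -- outside `U`, so `m` bad vertices give `m` distinct deleted pairs.
    set g : V → Sym2 V := fun w => if del s(u, w) = true then s(u, w) else s(v, w) with hg
    have hgd : ∀ w ∈ Z, del (g w) = true := by
      intro w hw
      have hw' := hZ hw
      simp only [hW, Finset.mem_sdiff, Finset.mem_filter, not_and] at hw'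
      by_cases h : del s(u, w) = true
      · simp [hg, h]
      · have := hw'.2 hw'.1 (by simpa using h)
        simp only [hg, h]
        simpa using this
    have hwU : ∀ w ∈ Z, w ∈ U := fun w hw => (Finset.mem_sdiff.1 (hZ hw)).1
    have hgi : Set.InjOn g Z := by
      intro a ha b hb hab
      have hau : a ≠ u := fun h => hu (h ▸ hwU a ha)
      have hav : a ≠ v := fun h => hv (h ▸ hwU a ha)
      have hbu : b ≠ u := fun h => hu (h ▸ hwU b hb)
      have hbv : b ≠ v := fun h => hv (h ▸ hwU b hb)
      simp only [hg] at hab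
      split_ifs at hab <;> simp only [Sym2.eq_iff] at hab <;> tauto
    obtain ⟨e, he, he'⟩ := h₁ (Z.image g)
      (by
        intro e he
        obtain ⟨w, hw, rfl⟩ := Finset.mem_image.1 he
        simp only [hg, spokePairs, Finset.mem_union, Finset.mem_image]
        split_ifs
        · exact Or.inl ⟨w, hwU w hw, rfl⟩
        · exact Or.inr ⟨w, hwU w hw, rfl⟩)
      (by rw [Finset.card_image_of_injOn hgi, hZc])
    obtain ⟨w, hw, rfl⟩ := Finset.mem_image.1 he
    simp [hgd w hw] at he'
  obtain ⟨W', hW', hWc'⟩ := Finset.exists_subset_card_eq hWc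
  obtain ⟨Q, hQ, hQc, hQd⟩ := h₂ W' (hW'.trans (Finset.filter_subset _ _)) hWc'
  obtain ⟨w, hw⟩ : Q.Nonempty := Finset.card_pos.1 (by omega)
  have hQW : ∀ a ∈ Q, a ∈ U ∧ del s(u, a) = false ∧ del s(v, a) = false := by
    intro a ha
    simpa [hW] using hW' (hQ ha)
  have adj : ∀ x, x ∉ U → x ∈ (insert u (insert v U) : Finset V) →
      (∀ a ∈ Q, del s(x, a) = false) →
      (cliqueFilter (perturbedGraph G del ins) τ).Adj x w := by
    intro x hxU hx hxd
    refine cliqueFilter_perturbedGraph_adj_of_isClique (K := insert x Q)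
      (Finset.mem_insert_self _ _) (Finset.mem_insert_of_mem hw) ?_ ?_ ?_ ?_
    · rintro rfl
      exact hxU (hQW x hw).1
    · refine hU.subset ?_
      intro a ha
      simp only [Finset.coe_insert, Set.mem_insert_iff, Finset.mem_coe] at ha
      rcases ha with rfl | ha
      · exact hx
      · simp [(hQW a ha).1]
    · have h1 : Q.card ≤ (insert x Q).card := Finset.card_le_card (Finset.subset_insert _ _)
      rw [hQc] at h1
      exact hτ.trans (by exact_mod_cast h1)
    · intro a ha b hb hab
      rcases Finset.mem_insert.1 ha with hax | ha <;> rcases Finset.mem_insert.1 hb with hbx | hb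
      · exact absurd (hax.trans hbx.symm) hab
      · rw [hax]; exact hxd b hb
      · rw [hbx, Sym2.eq_swap]; exact hxd a ha
      · exact hQd a ha b hb hab
  have h1 := adj u hu (by simp) fun a ha => (hQW a ha).2.1
  have h2 := adj v hv (by simp) fun a ha => (hQW a ha).2.2
  exact SimpleGraph.edist_le (SimpleGraph.Walk.cons h1 (SimpleGraph.Walk.cons h2.symm .nil))

end Deterministic

/-! ### Independent coins: union bounds, independence of disjoint blocks, second moment. -/

section Coins

variable {E : Type*} [Fintype E]

theorem coin_real_all_true (p : I) (S : Finset E) :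
    (Measure.pi fun _ : E => bernoulliMeasure true false p).real {ω | ∀ e ∈ S, ω e = true} =
      (p : ℝ) ^ S.card := by
  classical
  have h : {ω : E → Bool | ∀ e ∈ S, ω e = true} =
      Set.pi Set.univ fun e => if e ∈ S then {true} else Set.univ := by
    ext ω
    simp only [Set.mem_ofPred_eq, Set.mem_pi, Set.mem_univ, true_implies]
    refine forall_congr' fun e => ?_
    split_ifs with h <;> simp [h]
  rw [h, measureReal_def, Measure.pi_pi, ENNReal.toReal_prod, ← Finset.prod_const]
  rw [← Finset.prod_subset (Finset.subset_univ S)]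
  · refine Finset.prod_congr rfl fun e he => ?_
    rw [if_pos he, ← measureReal_def, bernoulliMeasure_real_apply_of_mem_of_notMem] <;> simp
  · intro e _ he
    simp [he]

theorem coin_real_all_false (p : I) (S : Finset E) :
    (Measure.pi fun _ : E => bernoulliMeasure true false p).real {ω | ∀ e ∈ S, ω e = false} =
      (1 - (p : ℝ)) ^ S.card := by
  classical
  have h : {ω : E → Bool | ∀ e ∈ S, ω e = false} =
      Set.pi Set.univ fun e => if e ∈ S then {false} else Set.univ := by
    ext ω
    simp only [Set.mem_ofPred_eq, Set.mem_pi, Set.mem_univ, true_implies]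
    refine forall_congr' fun e => ?_
    split_ifs with h <;> simp [h]
  rw [h, measureReal_def, Measure.pi_pi, ENNReal.toReal_prod, ← Finset.prod_const]
  rw [← Finset.prod_subset (Finset.subset_univ S)]
  · refine Finset.prod_congr rfl fun e he => ?_
    rw [if_pos he, ← measureReal_def, bernoulliMeasure_real_apply_of_notMem_of_mem] <;> simp
  · intro e _ he
    simp [he]

theorem measureReal_exists_mem_le {Ω ι : Type*} [MeasurableSpace Ω] (μ : Measure Ω)
    [IsFiniteMeasure μ] (s : Finset ι) (A : ι → Set Ω) {c : ℝ} (h : ∀ i ∈ s, μ.real (A i) ≤ c) :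
    μ.real {ω | ∃ i ∈ s, ω ∈ A i} ≤ s.card * c := by
  have : {ω | ∃ i ∈ s, ω ∈ A i} = ⋃ i ∈ s, A i := by ext; simp
  rw [this]
  refine (measureReal_biUnion_finset_le s A).trans ?_
  rw [← nsmul_eq_mul]
  exact Finset.sum_le_card_nsmul s _ c h

theorem coin_real_exists_subset_le (p : I) (T : Finset E) (j : ℕ) :
    (Measure.pi fun _ : E => bernoulliMeasure true false p).real
      {ω | ∃ S ⊆ T, S.card = j ∧ ∀ e ∈ S, ω e = true} ≤ T.card.choose j * (p : ℝ) ^ j := by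
  have h : {ω : E → Bool | ∃ S ⊆ T, S.card = j ∧ ∀ e ∈ S, ω e = true} =
      {ω | ∃ S ∈ T.powersetCard j, ω ∈ {ω : E → Bool | ∀ e ∈ S, ω e = true}} := by
    ext ω
    simp only [Set.mem_ofPred_eq, Finset.mem_powersetCard, and_assoc]
  rw [h, ← Finset.card_powersetCard]
  refine measureReal_exists_mem_le _ _ (fun S : Finset E => {ω : E → Bool | ∀ e ∈ S, ω e = true})
    fun S hS => ?_
  rw [coin_real_all_true, (Finset.mem_powersetCard.1 hS).2]

/-- An event determined by the coins in `D b` is a preimage under restriction to `D b`, and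
restrictions to disjoint coordinate sets are independent. -/
theorem coin_real_biInter_eq_prod {ι : Type*} (ν : E → Measure Bool)
    [∀ e, IsProbabilityMeasure (ν e)] (s : Finset ι)
    (A : ι → Set (E → Bool)) (D : ι → Finset E)
    (hD : ∀ b ∈ s, ∀ c ∈ s, b ≠ c → Disjoint (D b) (D c))
    (hA : ∀ b ∈ s, ∀ ω ω' : E → Bool, (∀ e ∈ D b, ω e = ω' e) → ω ∈ A b → ω' ∈ A b) :
    (Measure.pi ν).real {ω | ∀ b ∈ s, ω ∈ A b} = ∏ b ∈ s, (Measure.pi ν).real (A b) := by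
  classical
  induction s using Finset.induction_on with
  | empty => simp
  | insert c s hc ih =>
    rw [Finset.prod_insert hc, ← ih (fun b hb d hd => hD b (by simp [hb]) d (by simp [hd]))
      (fun b hb => hA b (by simp [hb]))]
    set B : Set (E → Bool) := {ω | ∀ b ∈ s, ω ∈ A b} with hB
    have hind : iIndepFun (fun (e : E) (ω : E → Bool) => ω e) (Measure.pi ν) :=
      iIndepFun_pi (X := fun _ ω => ω) fun e => aemeasurable_id
    have hdisj : Disjoint (D c) (s.biUnion D) := by
      rw [Finset.disjoint_biUnion_right]
      intro b hb
      exact hD c (by simp) b (by simp [hb]) (fun h => hc (h ▸ hb))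
    have hi := hind.indepFun_finset _ _ hdisj fun e => measurable_pi_apply e
    have hpre : ∀ (T : Finset E) (C : Set (E → Bool)),
        (∀ ω ω' : E → Bool, (∀ e ∈ T, ω e = ω' e) → ω ∈ C → ω' ∈ C) →
        C = (fun (ω : E → Bool) (e : T) => ω e) ⁻¹' ((fun (ω : E → Bool) (e : T) => ω e) '' C) := by
      intro T C hC
      refine (Set.subset_preimage_image _ _).antisymm ?_
      rintro ω' ⟨ω, hω, h⟩
      exact hC ω ω' (fun e he => congrFun h ⟨e, he⟩) hω
    have h1 := hpre (D c) (A c) (hA c (by simp))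
    have h2 := hpre (s.biUnion D) B (by
      intro ω ω' h hω b hb
      exact hA b (by simp [hb]) ω ω' (fun e he => h e (Finset.mem_biUnion.2 ⟨b, hb, he⟩)) (hω b hb))
    have h3 : {ω : E → Bool | ∀ b ∈ insert c s, ω ∈ A b} = A c ∩ B := by
      ext ω; simp [hB]
    rw [h3, measureReal_def, measureReal_def, measureReal_def, ← ENNReal.toReal_mul]
    congr 1
    have := hi.measure_inter_preimage_eq_mul _ _
      (.of_discrete (s := (fun (ω : E → Bool) (e : D c) => ω e) '' A c))
      (.of_discrete (s := (fun (ω : E → Bool) (e : (s.biUnion D : Finset E)) => ω e) '' B))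
    rwa [← h1, ← h2] at this

/-- The second moment method for the event that some set of a finite family is free of successes. -/
theorem coin_inv_le_real_exists [DecidableEq E] {ι : Type*} [Fintype ι] (p : I) (S : ι → Finset E)
    {C : ℝ} (hC : 0 < C) (hpos : 0 < ∑ f, (1 - (p : ℝ)) ^ (S f).card)
    (h : ∑ f, ∑ g, (1 - (p : ℝ)) ^ (S f ∪ S g).card ≤ C * (∑ f, (1 - (p : ℝ)) ^ (S f).card) ^ 2) :
    C⁻¹ ≤ (Measure.pi fun _ : E => bernoulliMeasure true false p).real
      {ω | ∃ f, ∀ e ∈ S f, ω e = false} := by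
  set P := Measure.pi fun _ : E => bernoulliMeasure true false p
  set t := 1 - (p : ℝ)
  set M := ∑ f, t ^ (S f).card
  set A : Finset E → Set (E → Bool) := fun T => {ω | ∀ e ∈ T, ω e = false} with hA
  have hP : ∀ T, P.real (A T) = t ^ T.card := fun T => coin_real_all_false p T
  set X : (E → Bool) → ℝ := fun ω => ∑ f, (A (S f)).indicator 1 ω with hX
  have hXi : ∫ ω, X ω ∂P = M := by
    rw [integral_finsetSum _ fun f _ => .of_finite]
    refine Finset.sum_congr rfl fun f _ => ?_
    rw [integral_indicator_one .of_discrete, hP]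
  have hX2 : ∀ ω, X ω ^ 2 = ∑ f, ∑ g, (A (S f ∪ S g)).indicator 1 ω := by
    intro ω
    rw [sq, hX, Finset.sum_mul_sum]
    refine Finset.sum_congr rfl fun f _ => Finset.sum_congr rfl fun g _ => ?_
    have : A (S f ∪ S g) = A (S f) ∩ A (S g) := by
      ext ω
      simp only [hA, Finset.mem_union, Set.mem_ofPred_eq, Set.mem_inter_iff]
      exact ⟨fun h => ⟨fun e he => h e (.inl he), fun e he => h e (.inr he)⟩,
        fun h e he => he.elim (h.1 e) (h.2 e)⟩
    rw [this, Set.inter_indicator_one, Pi.mul_apply]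
  have hX2i : ∫ ω, X ω ^ 2 ∂P ≤ C * M ^ 2 := by
    refine le_trans (le_of_eq ?_) h
    simp_rw [hX2]
    rw [integral_finsetSum _ fun f _ => .of_finite]
    refine Finset.sum_congr rfl fun f _ => ?_
    rw [integral_finsetSum _ fun f _ => .of_finite]
    refine Finset.sum_congr rfl fun g _ => ?_
    rw [integral_indicator_one .of_discrete, hP]
  set F : Set (E → Bool) := {ω | ∃ f, ∀ e ∈ S f, ω e = false} with hF
  -- A pointwise form of Cauchy-Schwarz: on `F` it is `(X/(CM) - 1)² ≥ 0`, off `F` the count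
  -- vanishes. Integration gives `2/C - 1/C`.
  have hpt : ∀ ω, 2 / (C * M) * X ω - 1 / (C * M) ^ 2 * X ω ^ 2 ≤ F.indicator 1 ω := by
    intro ω
    by_cases hω : ω ∈ F
    · rw [Set.indicator_of_mem hω, Pi.one_apply]
      have : 0 ≤ (X ω / (C * M) - 1) ^ 2 := sq_nonneg _
      have e : (X ω / (C * M) - 1) ^ 2 =
        1 - (2 / (C * M) * X ω - 1 / (C * M) ^ 2 * X ω ^ 2) := by field_simp; ring
      linarith
    · rw [Set.indicator_of_notMem hω]
      have : X ω = 0 := by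
        refine Finset.sum_eq_zero fun f _ => Set.indicator_of_notMem ?_ _
        exact fun h => hω ⟨f, h⟩
      simp [this]
  have hint := integral_mono (μ := P) .of_finite .of_finite hpt
  rw [integral_indicator_one .of_discrete, integral_sub .of_finite .of_finite,
    integral_const_mul, integral_const_mul, hXi] at hint
  refine le_trans ?_ hint
  have : 1 / (C * M) ^ 2 * ∫ ω, X ω ^ 2 ∂P ≤ 1 / (C * M) ^ 2 * (C * M ^ 2) := by gcongr
  have e1 : 1 / (C * M) ^ 2 * (C * M ^ 2) = C⁻¹ := by field_simp
  have e2 : 2 / (C * M) * M = 2 * C⁻¹ := by field_simp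
  linarith

end Coins

/-! ### Surviving cliques in multipartite blocks. -/

section Transversal

/-- The power factors over coordinates; for fixed `f`, each coordinate of `g` contributes `B` once
and 1 the other `a - 1` times. -/
theorem sum_sum_pow_card_eq {k a : ℕ} (B : ℝ) :
    ∑ f : Fin k → Fin a, ∑ g : Fin k → Fin a, B ^ (Finset.univ.filter fun i => f i = g i).card =
      (a : ℝ) ^ k * (a - 1 + B) ^ k := by
  have h : ∀ f : Fin k → Fin a,
      ∑ g : Fin k → Fin a, B ^ (Finset.univ.filter fun i => f i = g i).card =
        (a - 1 + B) ^ k := by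
    intro f
    have h1 : ∀ g : Fin k → Fin a, B ^ (Finset.univ.filter fun i => f i = g i).card =
        ∏ i, if f i = g i then B else 1 := by
      intro g
      rw [Finset.prod_ite]
      simp
    simp_rw [h1]
    rw [← Fintype.prod_sum (fun i (y : Fin a) => if f i = y then B else (1 : ℝ))]
    rw [Finset.prod_congr rfl (g := fun _ => (a - 1 + B)), Finset.prod_const, Finset.card_univ,
      Fintype.card_fin]
    intro i _
    have h2 : ∀ y : Fin a, (if f i = y then B else (1 : ℝ)) = 1 + if f i = y then B - 1 else 0 := by
      intro y; split_ifs <;> ring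
    simp_rw [h2, Finset.sum_add_distrib]
    simp
    ring
  simp_rw [h]
  simp

variable {V : Type*} [DecidableEq V]

/-- The pairs of vertices of the transversal `i ↦ ψ i (f i)`. -/
def transversalPairs {k a : ℕ} (ψ : Fin k → Fin a → V) (f : Fin k → Fin a) : Finset (Sym2 V) :=
  ((Finset.univ : Finset (Fin k)).image fun i => ψ i (f i)).offDiag.image Sym2.mk.uncurry

theorem card_transversalPairs {k a : ℕ} {ψ : Fin k → Fin a → V}
    (hψ : Function.Injective fun x : Fin k × Fin a => ψ x.1 x.2) (f : Fin k → Fin a) :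
    (transversalPairs ψ f).card = k.choose 2 := by
  rw [transversalPairs, Sym2.card_image_offDiag, Finset.card_image_of_injective,
    Finset.card_univ, Fintype.card_fin]
  intro i j h
  exact congrArg Prod.fst (hψ (a₁ := (i, f i)) (a₂ := (j, f j)) h)

/-- Injectivity of `ψ` recovers part and index from a vertex, so both endpoints of a shared pair
come from parts where `f` and `g` agree. -/
theorem card_transversalPairs_inter_le {k a : ℕ} {ψ : Fin k → Fin a → V}
    (hψ : Function.Injective fun x : Fin k × Fin a => ψ x.1 x.2) (f g : Fin k → Fin a) :
    (transversalPairs ψ f ∩ transversalPairs ψ g).card ≤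
      (Finset.univ.filter fun i => f i = g i).card.choose 2 := by
  set J := Finset.univ.filter fun i => f i = g i with hJ
  have hcard : (J.image fun i => ψ i (f i)).card = J.card := by
    refine Finset.card_image_of_injective _ fun i j h => ?_
    exact congrArg Prod.fst (hψ (a₁ := (i, f i)) (a₂ := (j, f j)) h)
  rw [← hcard, ← Sym2.card_image_offDiag]
  refine Finset.card_le_card fun e he => ?_
  rw [Finset.mem_inter, transversalPairs, transversalPairs] at he
  have key : ∀ v, v ∈ (Finset.univ : Finset (Fin k)).image (fun i => ψ i (f i)) →
      v ∈ (Finset.univ : Finset (Fin k)).image (fun i => ψ i (g i)) →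
      v ∈ J.image fun i => ψ i (f i) := by
    intro v h1 h2
    obtain ⟨i, -, rfl⟩ := Finset.mem_image.1 h1
    obtain ⟨j, -, hj⟩ := Finset.mem_image.1 h2
    have := hψ (a₁ := (j, g j)) (a₂ := (i, f i)) hj
    simp only [Prod.mk.injEq] at this
    obtain ⟨rfl, h⟩ := this
    exact Finset.mem_image.2 ⟨j, by simp [hJ, h], rfl⟩
  obtain ⟨⟨x, y⟩, hxy, rfl⟩ := Finset.mem_image.1 he.1
  obtain ⟨⟨x', y'⟩, hxy', he'⟩ := Finset.mem_image.1 he.2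
  simp only [Function.uncurry, Sym2.eq_iff] at he'
  rw [Finset.mem_offDiag] at hxy hxy'
  refine Finset.mem_image.2 ⟨(x, y), ?_, rfl⟩
  rw [Finset.mem_offDiag]
  rcases he' with ⟨rfl, rfl⟩ | ⟨rfl, rfl⟩
  · exact ⟨key _ hxy.1 hxy'.1, key _ hxy.2.1 hxy'.2.1, hxy.2.2⟩
  · exact ⟨key _ hxy.1 hxy'.2.1, key _ hxy.2.1 hxy'.1, hxy.2.2⟩

/-- Second moment of the number of surviving transversals. Correlation enters only through shared
pairs, and parts of size `a ≥ k b^k`, with `b = (1-p)^{-1/2}`, keep the second moment within `(1 +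
b^k/a)^k ≤ e < 3` times the squared mean. -/
theorem coin_third_le_real_exists_transversal [Fintype V] (p : I) (hp : (p : ℝ) < 1) {k a : ℕ}
    (hk : 1 ≤ k) (ψ : Fin k → Fin a → V)
    (hψ : Function.Injective fun x : Fin k × Fin a => ψ x.1 x.2)
    (hka : k * (1 / √(1 - (p : ℝ))) ^ k ≤ a) :
    1 / 3 ≤ (Measure.pi fun _ : Sym2 V => bernoulliMeasure true false p).real
      {ω | ∃ f : Fin k → Fin a, ∀ e ∈ transversalPairs ψ f, ω e = false} := by
  set t := 1 - (p : ℝ) with ht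
  have ht0 : 0 < t := by rw [ht]; linarith
  have ht1 : t ≤ 1 := by rw [ht]; linarith [p.2.1]
  set b := 1 / √t with hb
  have hb1 : 1 ≤ b := by
    rw [hb, one_le_div (Real.sqrt_pos.2 ht0)]
    exact Real.sqrt_le_one.2 ht1
  have hb2 : b ^ 2 = t⁻¹ := by
    rw [hb, div_pow, Real.sq_sqrt ht0.le, one_pow, one_div]
  have ha : (0 : ℝ) < a := lt_of_lt_of_le (by positivity) hka
  have hE : ∑ f : Fin k → Fin a, t ^ (transversalPairs ψ f).card =
      (a : ℝ) ^ k * t ^ (k.choose 2) := by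
    simp_rw [card_transversalPairs hψ]
    simp
  have hexp : Real.exp 1 ≤ 3 := by linarith [Real.exp_one_lt_d9]
  have hmain := coin_inv_le_real_exists p (transversalPairs ψ) (C := 3) (by norm_num)
    (by rw [hE]; positivity) ?_
  · rw [one_div]; exact hmain
  rw [hE]
  have hterm : ∀ f g : Fin k → Fin a, t ^ (transversalPairs ψ f ∪ transversalPairs ψ g).card ≤
      t ^ (2 * k.choose 2) * (b ^ k) ^ (Finset.univ.filter fun i => f i = g i).card := by
    intro f g
    set J := (Finset.univ.filter fun i => f i = g i).card with hJ
    have hJk : J ≤ k := by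
      rw [hJ]; exact (Finset.card_le_univ _).trans (by simp)
    have h1 := Finset.card_union_add_card_inter (transversalPairs ψ f) (transversalPairs ψ g)
    rw [card_transversalPairs hψ, card_transversalPairs hψ, ← two_mul] at h1
    have h2 := card_transversalPairs_inter_le hψ f g
    rw [← hJ] at h2
    set c := (transversalPairs ψ f ∩ transversalPairs ψ g).card
    -- Bounding `J (J - 1)` by `k J` makes the exponent linear in the number of agreements, so that
    -- the double sum factors over coordinates.
    have h3 : (t⁻¹) ^ c ≤ (b ^ k) ^ J := by
      rw [← hb2, ← pow_mul, ← pow_mul]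
      refine pow_le_pow_right₀ hb1 ?_
      calc 2 * c ≤ 2 * J.choose 2 := by omega
        _ ≤ J * (J - 1) := by rw [Nat.choose_two_right]; exact Nat.mul_div_le _ _
        _ ≤ k * J := by rw [mul_comm k]; exact Nat.mul_le_mul_left _ (by omega)
    calc t ^ (transversalPairs ψ f ∪ transversalPairs ψ g).card
        = t ^ (2 * k.choose 2) * (t⁻¹) ^ c := by
          rw [← h1, pow_add, inv_pow]; field_simp
      _ ≤ _ := by gcongr
  calc ∑ f, ∑ g, t ^ (transversalPairs ψ f ∪ transversalPairs ψ g).card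
      ≤ ∑ f : Fin k → Fin a, ∑ g : Fin k → Fin a,
        t ^ (2 * k.choose 2) * (b ^ k) ^ (Finset.univ.filter fun i => f i = g i).card :=
        Finset.sum_le_sum fun f _ => Finset.sum_le_sum fun g _ => hterm f g
    _ = t ^ (2 * k.choose 2) * ((a : ℝ) ^ k * (a - 1 + b ^ k) ^ k) := by
        simp_rw [← Finset.mul_sum]
        rw [sum_sum_pow_card_eq]
    _ ≤ t ^ (2 * k.choose 2) * ((a : ℝ) ^ k * ((a : ℝ) ^ k * 3)) := by
        gcongr
        calc (a - 1 + b ^ k) ^ k ≤ (a * (1 + b ^ k / a)) ^ k := by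
              refine pow_le_pow_left₀ ?_ ?_ k
              · have : 1 ≤ b ^ k := one_le_pow₀ hb1
                linarith
              · rw [mul_add, mul_one, mul_div_cancel₀ _ ha.ne']; linarith
          _ = (a : ℝ) ^ k * (1 + b ^ k / a) ^ k := mul_pow _ _ _
          _ ≤ (a : ℝ) ^ k * 3 := by
              gcongr
              calc (1 + b ^ k / a) ^ k ≤ (Real.exp (b ^ k / a)) ^ k := by
                    gcongr
                    rw [add_comm]; exact Real.add_one_le_exp _
                _ = Real.exp (k * (b ^ k / a)) := by rw [← Real.exp_nat_mul]
                _ ≤ Real.exp 1 := by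
                    rw [Real.exp_le_exp, ← mul_div_assoc, div_le_one ha]; exact hka
                _ ≤ 3 := hexp
    _ = 3 * ((a : ℝ) ^ k * t ^ k.choose 2) ^ 2 := by ring

theorem card_image_transversal {k a : ℕ} {ψ : Fin k → Fin a → V}
    (hψ : Function.Injective fun x : Fin k × Fin a => ψ x.1 x.2) (f : Fin k → Fin a) :
    ((Finset.univ : Finset (Fin k)).image fun i => ψ i (f i)).card = k := by
  rw [Finset.card_image_of_injective, Finset.card_univ, Fintype.card_fin]
  intro i j h
  exact congrArg Prod.fst (hψ (a₁ := (i, f i)) (a₂ := (j, f j)) h)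

/-- A vertex set of size at least `k * (k * P) * a` carries `P ^ 2` many `k`-partite blocks with
parts of size `a` such that no two blocks share a pair from different parts; hence the
absence of a `k`-clique is exponentially unlikely in `P ^ 2`. -/
theorem coin_real_no_clique_le [Fintype V] (p : I) (hp : (p : ℝ) < 1) {k a P : ℕ}
    (hk : 1 ≤ k) (hka : k * (1 / √(1 - (p : ℝ))) ^ k ≤ a) (W : Finset V)
    (hW : k * (k * P) * a ≤ W.card) :
    (Measure.pi fun _ : Sym2 V => bernoulliMeasure true false p).real
      {ω | ¬ ∃ Q ⊆ W, Q.card = k ∧ ∀ x ∈ Q, ∀ y ∈ Q, x ≠ y → ω s(x, y) = false} ≤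
        (2 / 3 : ℝ) ^ (P ^ 2) := by
  obtain ⟨φ⟩ : Nonempty (Fin k × Fin (k * P) × Fin a ↪ W) := by
    refine Function.Embedding.nonempty_of_card_le ?_
    simpa [mul_assoc] using hW
  have hlt : ∀ (c : Fin P × Fin P) (i : Fin k), c.1.val * i.val + c.2.val < k * P := by
    intro c i
    have h1 : c.1.val * i.val ≤ (P - 1) * (k - 1) :=
      Nat.mul_le_mul (by have := c.1.2; omega) (by have := i.2; omega)
    have h2 := c.2.2
    have h3 : (P - 1) * (k - 1) + P ≤ k * P := by
      obtain ⟨k', rfl⟩ : ∃ k', k = k' + 1 := ⟨k - 1, by omega⟩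
      have : (P - 1) * k' ≤ P * k' := Nat.mul_le_mul_right _ (by omega)
      simp only [Nat.add_sub_cancel]
      nlinarith
    omega
  -- Block `c` follows a line of slope `c.1` and intercept `c.2`: in part `i` it takes the cell `c.1
  -- * i + c.2`. All these cells fit into `k * P` columns.
  set ψ : Fin P × Fin P → Fin k → Fin a → V :=
    fun c i x => φ (i, ⟨c.1.val * i.val + c.2.val, hlt c i⟩, x) with hψdef
  have hψeq : ∀ c c' i i' x x', ψ c i x = ψ c' i' x' → i = i' ∧ x = x' ∧
      c.1.val * i.val + c.2.val = c'.1.val * i'.val + c'.2.val := by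
    intro c c' i i' x x' h
    have := φ.injective (Subtype.ext h)
    simp only [Prod.mk.injEq, Fin.mk.injEq] at this
    exact ⟨this.1, this.2.2, this.2.1⟩
  have hψ : ∀ c, Function.Injective fun x : Fin k × Fin a => ψ c x.1 x.2 := by
    intro c x y h
    obtain ⟨h1, h2, -⟩ := hψeq _ _ _ _ _ _ h
    exact Prod.ext h1 h2
  set A : Fin P × Fin P → Set (Sym2 V → Bool) :=
    fun c => {ω | ∃ f : Fin k → Fin a, ∀ e ∈ transversalPairs (ψ c) f, ω e = false} with hA
  set D : Fin P × Fin P → Finset (Sym2 V) :=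
    fun c => Finset.univ.biUnion (transversalPairs (ψ c)) with hD
  have hmemD : ∀ {c e}, e ∈ D c → ∃ i j x y, i ≠ j ∧ e = s(ψ c i x, ψ c j y) := by
    intro c e he
    simp only [hD, Finset.mem_biUnion, Finset.mem_univ, true_and, transversalPairs] at he
    obtain ⟨f, hf⟩ := he
    obtain ⟨⟨u, v⟩, huv, rfl⟩ := Finset.mem_image.1 hf
    rw [Finset.mem_offDiag] at huv
    obtain ⟨i, -, hi⟩ := Finset.mem_image.1 huv.1
    obtain ⟨j, -, hj⟩ := Finset.mem_image.1 huv.2.1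
    dsimp only at hi hj
    refine ⟨i, j, f i, f j, ?_, by rw [hi, hj]; rfl⟩
    rintro rfl
    exact huv.2.2 (hi.symm.trans hj)
  -- Two lines meeting at two abscissae coincide; therefore distinct blocks share no pair across
  -- parts and use disjoint coins.
  have hsolve : ∀ (c c' : Fin P × Fin P) (i j : Fin k), i ≠ j →
      c.1.val * i.val + c.2.val = c'.1.val * i.val + c'.2.val →
      c.1.val * j.val + c.2.val = c'.1.val * j.val + c'.2.val → c = c' := by
    intro c c' i j hij h1 h2
    have hij' : (i.val : ℤ) - j.val ≠ 0 := by
      intro h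
      exact hij (Fin.ext (by omega))
    have e : ((c.1.val : ℤ) - c'.1.val) * ((i.val : ℤ) - j.val) = 0 := by
      zify at h1 h2
      linear_combination h1 - h2
    have h3 : c.1.val = c'.1.val := by
      rcases mul_eq_zero.1 e with h | h
      · omega
      · exact absurd h hij'
    rw [h3] at h1
    exact Prod.ext (Fin.ext h3) (Fin.ext (by omega))
  have hdisj : ∀ c ∈ (Finset.univ : Finset (Fin P × Fin P)), ∀ c' ∈ Finset.univ, c ≠ c' →
      Disjoint (D c) (D c') := by
    intro c _ c' _ hcc
    rw [Finset.disjoint_left]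
    intro e he he'
    obtain ⟨i, j, x, y, hij, rfl⟩ := hmemD he
    obtain ⟨i', j', x', y', -, h⟩ := hmemD he'
    rw [Sym2.eq_iff] at h
    rcases h with ⟨h1, h2⟩ | ⟨h1, h2⟩ <;>
    · obtain ⟨rfl, -, h1⟩ := hψeq _ _ _ _ _ _ h1
      obtain ⟨rfl, -, h2⟩ := hψeq _ _ _ _ _ _ h2
      exact hcc (hsolve c c' _ _ hij h1 h2)
  have hdet : ∀ c ∈ (Finset.univ : Finset (Fin P × Fin P)), ∀ ω ω' : Sym2 V → Bool,
      (∀ e ∈ D c, ω e = ω' e) → ω ∈ (A c)ᶜ → ω' ∈ (A c)ᶜ := by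
    rintro c - ω ω' h hω ⟨f, hf⟩
    refine hω ⟨f, fun e he => ?_⟩
    rw [h e (Finset.mem_biUnion.2 ⟨f, Finset.mem_univ _, he⟩)]
    exact hf e he
  have hprod := coin_real_biInter_eq_prod (fun _ : Sym2 V => bernoulliMeasure true false p)
    Finset.univ (fun c => (A c)ᶜ) D hdisj hdet
  have hle : ∀ c, (Measure.pi fun _ : Sym2 V => bernoulliMeasure true false p).real (A c)ᶜ ≤
      2 / 3 := by
    intro c
    rw [measureReal_compl .of_discrete]
    have := coin_third_le_real_exists_transversal p hp hk (ψ c) (hψ c) hka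
    simp only [hA, probReal_univ]
    linarith
  calc _ ≤ (Measure.pi fun _ : Sym2 V => bernoulliMeasure true false p).real
        {ω | ∀ c ∈ (Finset.univ : Finset (Fin P × Fin P)), ω ∈ (A c)ᶜ} := by
        refine measureReal_mono fun ω hω c _ hc => hω ?_
        obtain ⟨f, hf⟩ := hc
        refine ⟨Finset.univ.image fun i => ψ c i (f i), ?_, card_image_transversal (hψ c) f, ?_⟩
        · intro v hv
          obtain ⟨i, -, rfl⟩ := Finset.mem_image.1 hv
          exact (φ _).2
        · intro x hx y hy hxy
          exact hf _ (Finset.mem_image.2 ⟨(x, y), Finset.mem_offDiag.2 ⟨hx, hy, hxy⟩, rfl⟩)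
    _ = ∏ c, (Measure.pi fun _ : Sym2 V => bernoulliMeasure true false p).real (A c)ᶜ := hprod
    _ ≤ ∏ c : Fin P × Fin P, (2 / 3 : ℝ) :=
        Finset.prod_le_prod (fun _ _ => measureReal_nonneg) fun c _ => hle c
    _ = _ := by simp [sq, div_pow]

end Transversal

/-! ### Failure probabilities of insertions and deletions on a fixed true graph. -/

section PerturbationBounds

variable {V : Type*}

theorem card_spokePairs_le (u v : V) (U : Finset V) :
    (spokePairs u v U).card ≤ 2 * U.card := by
  classical
  rw [spokePairs, two_mul]
  exact (Finset.card_union_le _ _).trans (add_le_add Finset.card_image_le Finset.card_image_le)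

variable [Fintype V]

theorem card_farPairs_le (G : SimpleGraph V) (x z : V) :
    (farPairs G x z).card ≤ (closedNbrs G x).card := by
  classical
  rw [farPairs]
  exact Finset.card_image_le.trans (Finset.card_le_card Finset.sdiff_subset)

/-- The insertion coins for which some filtered edge may join vertices at distance more than two. -/
def insertionFailure (G : SimpleGraph V) (k j : ℕ) : Set (Sym2 V → Bool) :=
  {ins | (∃ x z, ∃ S ⊆ farPairs G x z, S.card = j ∧ ∀ e ∈ S, ins e = true) ∨
    ∃ K : Finset V, K.card = k ∧ k * k ≤ 4 * (nonadjPairs G K).card ∧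
      ∀ e ∈ nonadjPairs G K, ins e = true}

theorem edist_le_two_of_notMem_insertionFailure {G : SimpleGraph V} {del ins : Sym2 V → Bool}
    {τ : ℝ} {k j : ℕ} (hk : k = max 2 ⌈τ⌉₊) (hj : 4 * j ≤ k + 3)
    (hins : ins ∉ insertionFailure G k j) {u v : V}
    (huv : (cliqueFilter (perturbedGraph G del ins) τ).Adj u v) : G.edist u v ≤ 2 := by
  simp only [insertionFailure, Set.mem_ofPred_eq, not_or, not_exists, not_and, not_forall,
    Bool.not_eq_true] at hins
  refine edist_le_two_of_cliqueFilter_adj hk hj ?_ ?_ huv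
  · intro x z S hS hc
    obtain ⟨e, he, h⟩ := hins.1 x z S hS hc
    exact ⟨e, he, h⟩
  · intro K hK hc
    obtain ⟨e, he, h⟩ := hins.2 K hK hc
    exact ⟨e, he, h⟩

/-- Union bound over pairs `(x, z)` for the first kind of failure and over `k`-sets for the second;
`l` is at most `⌈k²/4⌉`. -/
theorem coin_real_insertionFailure_le (q : I) (G : SimpleGraph V) {k j l M : ℕ}
    (hM : ∀ x, (closedNbrs G x).card ≤ M) (hl : 4 * l ≤ k * k + 3) :
    (Measure.pi fun _ : Sym2 V => bernoulliMeasure true false q).real (insertionFailure G k j) ≤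
      (Fintype.card V : ℝ) ^ 2 * (M.choose j * (q : ℝ) ^ j) +
        (Fintype.card V : ℝ) ^ k * (q : ℝ) ^ l := by
  classical
  set μ := Measure.pi fun _ : Sym2 V => bernoulliMeasure true false q
  have h1 : μ.real {ins | ∃ a ∈ (Finset.univ : Finset (V × V)),
      ins ∈ {ins : Sym2 V → Bool |
        ∃ S ⊆ farPairs G a.1 a.2, S.card = j ∧ ∀ e ∈ S, ins e = true}} ≤
      (Finset.univ : Finset (V × V)).card * (M.choose j * (q : ℝ) ^ j) := by
    refine measureReal_exists_mem_le μ _ (fun a : V × V => {ins : Sym2 V → Bool |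
      ∃ S ⊆ farPairs G a.1 a.2, S.card = j ∧ ∀ e ∈ S, ins e = true}) fun a _ => ?_
    refine (coin_real_exists_subset_le q _ j).trans ?_
    have : (farPairs G a.1 a.2).card.choose j ≤ M.choose j :=
      Nat.choose_le_choose j ((card_farPairs_le G _ _).trans (hM _))
    have hq := q.2.1
    gcongr
  have h2 : μ.real {ins | ∃ K ∈ (Finset.univ : Finset V).powersetCard k,
      ins ∈ {ins : Sym2 V → Bool | k * k ≤ 4 * (nonadjPairs G K).card ∧
        ∀ e ∈ nonadjPairs G K, ins e = true}} ≤
      ((Finset.univ : Finset V).powersetCard k).card * (q : ℝ) ^ l := by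
    refine measureReal_exists_mem_le μ _ (fun K : Finset V => {ins : Sym2 V → Bool |
      k * k ≤ 4 * (nonadjPairs G K).card ∧ ∀ e ∈ nonadjPairs G K, ins e = true}) fun K _ => ?_
    by_cases hK : k * k ≤ 4 * (nonadjPairs G K).card
    · simp only [hK, true_and]
      rw [coin_real_all_true]
      exact pow_le_pow_of_le_one q.2.1 q.2.2 (by omega)
    · simp only [hK, false_and]
      simpa using pow_nonneg q.2.1 l
  rw [Finset.card_powersetCard] at h2
  have h3 : ((Finset.univ : Finset V).card.choose k : ℝ) ≤ (Fintype.card V : ℝ) ^ k := by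
    rw [Finset.card_univ]
    exact_mod_cast Nat.choose_le_pow _ _
  have h4 : ((Finset.univ : Finset (V × V)).card : ℝ) = (Fintype.card V : ℝ) ^ 2 := by
    rw [Finset.card_univ, Fintype.card_prod]; push_cast; ring
  have hq := q.2.1
  calc μ.real (insertionFailure G k j) ≤ μ.real (_ ∪ _) := measureReal_mono ?_
    _ ≤ _ := measureReal_union_le _ _
    _ ≤ _ := add_le_add h1 h2
    _ ≤ _ := by rw [h4]; gcongr
  rintro ins (⟨x, z, h⟩ | ⟨K, hK, h⟩)
  · exact Or.inl ⟨(x, z), Finset.mem_univ _, h⟩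
  · exact Or.inr ⟨K, Finset.mem_powersetCard.2 ⟨Finset.subset_univ _, hK⟩, h⟩

open Classical in
/-- Every edge `uv` of `G` extends to a clique by at least `N` further vertices. -/
def EdgesInCliques (G : SimpleGraph V) (N : ℝ) : Prop :=
  ∀ u v, G.Adj u v → ∃ U : Finset V, u ∉ U ∧ v ∉ U ∧ N ≤ U.card ∧
    G.IsClique (insert u (insert v U) : Finset V)

/-- The deletion coins for which some edge of `G` may have endpoints at distance more than two in
the filtered graph. -/
def deletionFailure (G : SimpleGraph V) (τ : ℝ) : Set (Sym2 V → Bool) :=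
  {del | ∃ u v, G.Adj u v ∧
    ∃ ins, ¬ (cliqueFilter (perturbedGraph G del ins) τ).edist u v ≤ 2}

/-- Almost surely nothing is deleted, so the clique around each true edge survives and the edge
itself passes the filter. -/
theorem coin_zero_real_deletionFailure_eq_zero {G : SimpleGraph V} {N τ : ℝ}
    (hG : EdgesInCliques G N) (hτ : τ ≤ N) :
    (Measure.pi fun _ : Sym2 V => bernoulliMeasure true false (0 : I)).real
      (deletionFailure G τ) = 0 := by
  classical
  refine le_antisymm ?_ measureReal_nonneg
  have h := measureReal_exists_mem_le
    (Measure.pi fun _ : Sym2 V => bernoulliMeasure true false (0 : I)) Finset.univ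
    (fun e : Sym2 V => {del : Sym2 V → Bool | ∀ e' ∈ ({e} : Finset (Sym2 V)), del e' = true})
    (c := 0) (fun e _ => by rw [coin_real_all_true]; simp)
  rw [mul_zero] at h
  refine (measureReal_mono ?_).trans h
  rintro del ⟨u, v, huv, ins, hd⟩
  by_contra hall
  simp only [Set.mem_ofPred_eq, Finset.mem_univ, Finset.mem_singleton, forall_eq, true_and,
    not_exists, Bool.not_eq_true] at hall
  obtain ⟨U, hu, hv, hN, hU⟩ := hG u v huv
  refine hd ?_
  have hadj := cliqueFilter_perturbedGraph_adj_of_isClique (τ := τ) (del := del) (ins := ins)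
    (u := u) (v := v)
    (K := insert u (insert v U)) (by simp) (by simp) huv.ne hU
    (hτ.trans (hN.trans (by
      exact_mod_cast Finset.card_le_card
        ((Finset.subset_insert v U).trans (Finset.subset_insert u _)))))
    (fun a _ b _ _ => hall _)
  exact (SimpleGraph.edist_le_one_iff_adj_or_eq.2 (Or.inl hadj)).trans (by norm_num)

/-- Each edge can fail in two ways: `m` deleted pairs among at most `4 * m` spokes, whence `16^m
p^m`, or an `m`-subset of the `2 * m` clique vertices without a surviving `k`-clique, whence the
factor `4^m`. -/
theorem coin_real_deletionFailure_le {G : SimpleGraph V} {N τ : ℝ} (hG : EdgesInCliques G N)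
    (p : I) (hp : (p : ℝ) < 1) {m k a P : ℕ} (hm : 2 * (m : ℝ) ≤ N) (hk : 1 ≤ k)
    (hτ : τ ≤ k) (hka : k * (1 / √(1 - (p : ℝ))) ^ k ≤ a) (hP : k * (k * P) * a ≤ m) :
    (Measure.pi fun _ : Sym2 V => bernoulliMeasure true false p).real (deletionFailure G τ) ≤
      (Fintype.card V : ℝ) ^ 2 * ((16 * p : ℝ) ^ m + 4 ^ m * (2 / 3 : ℝ) ^ (P ^ 2)) := by
  classical
  set μ := Measure.pi fun _ : Sym2 V => bernoulliMeasure true false p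
  have hp0 := p.2.1
  set F : V × V → Set (Sym2 V → Bool) := fun c => {del | G.Adj c.1 c.2 ∧
    ∃ ins, ¬ (cliqueFilter (perturbedGraph G del ins) τ).edist c.1 c.2 ≤ 2} with hF
  have h4 : ((Finset.univ : Finset (V × V)).card : ℝ) = (Fintype.card V : ℝ) ^ 2 := by
    rw [Finset.card_univ, Fintype.card_prod]; push_cast; ring
  have hmain : ∀ c, μ.real (F c) ≤ (16 * p : ℝ) ^ m + 4 ^ m * (2 / 3 : ℝ) ^ (P ^ 2) := by
    rintro ⟨u, v⟩
    by_cases huv : G.Adj u v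
    swap
    · have : F (u, v) = ∅ := by ext; simp [hF, huv]
      rw [this, measureReal_empty]
      positivity
    obtain ⟨U', hu', hv', hN, hU'⟩ := hG u v huv
    obtain ⟨U, hUU, hUc⟩ := Finset.exists_subset_card_eq (s := U') (n := 2 * m)
      (by exact_mod_cast hm.trans hN)
    have hU : G.IsClique (insert u (insert v U) : Finset V) := hU'.subset (by
      exact_mod_cast Finset.insert_subset_insert u (Finset.insert_subset_insert v hUU))
    have hu : u ∉ U := fun h => hu' (hUU h)
    have hv : v ∉ U := fun h => hv' (hUU h)
    have b1 : μ.real {del | ∃ S ⊆ spokePairs u v U, S.card = m ∧ ∀ e ∈ S, del e = true} ≤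
        (16 * p : ℝ) ^ m := by
      refine (coin_real_exists_subset_le p _ m).trans ?_
      have hc : (spokePairs u v U).card.choose m ≤ 16 ^ m := by
        calc _ ≤ 2 ^ (spokePairs u v U).card := Nat.choose_le_two_pow _ _
          _ ≤ 2 ^ (4 * m) := Nat.pow_le_pow_right (by norm_num)
              ((card_spokePairs_le u v U).trans (by omega))
          _ = 16 ^ m := by rw [pow_mul]; norm_num
      rw [mul_pow]
      gcongr
      exact_mod_cast hc
    have b2 : μ.real {del | ∃ W ∈ U.powersetCard m, del ∈ {del : Sym2 V → Bool |
        ¬ ∃ Q ⊆ W, Q.card = k ∧ ∀ x ∈ Q, ∀ y ∈ Q, x ≠ y → del s(x, y) = false}} ≤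
        4 ^ m * (2 / 3 : ℝ) ^ (P ^ 2) := by
      refine (measureReal_exists_mem_le μ _ (fun W : Finset V => {del : Sym2 V → Bool |
        ¬ ∃ Q ⊆ W, Q.card = k ∧ ∀ x ∈ Q, ∀ y ∈ Q, x ≠ y → del s(x, y) = false})
        fun W hW => coin_real_no_clique_le p hp hk hka W
          (hP.trans (Finset.mem_powersetCard.1 hW).2.ge)).trans ?_
      gcongr
      rw [Finset.card_powersetCard, hUc]
      have : (2 * m).choose m ≤ 4 ^ m := by
        calc _ ≤ 2 ^ (2 * m) := Nat.choose_le_two_pow _ _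
          _ = 4 ^ m := by rw [pow_mul]; norm_num
      exact_mod_cast this
    calc μ.real (F (u, v)) ≤ μ.real (_ ∪ _) := measureReal_mono ?_
      _ ≤ _ := measureReal_union_le _ _
      _ ≤ _ := add_le_add b1 b2
    rintro del ⟨-, ins, hd⟩
    by_contra hno
    rw [Set.mem_union, not_or] at hno
    simp only [Set.mem_ofPred_eq, not_exists, not_and, not_forall, Finset.mem_powersetCard,
      not_not] at hno
    refine hd (edist_cliqueFilter_le_two hu hv hU hUc hk hτ ?_ ?_)
    · intro S hS hc
      obtain ⟨e, he, h⟩ := hno.1 S hS hc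
      exact ⟨e, he, by simpa using h⟩
    · intro W hW hc
      obtain ⟨Q, h1, h2, h3⟩ := hno.2 W ⟨hW, hc⟩
      exact ⟨Q, h1, h2, h3⟩
  have hsum := measureReal_exists_mem_le μ Finset.univ F fun c _ => hmain c
  rw [h4] at hsum
  refine (measureReal_mono ?_).trans hsum
  rintro del ⟨u, v, huv⟩
  exact ⟨(u, v), Finset.mem_univ _, huv⟩

end PerturbationBounds

/-! ### The random sample points: Chernoff bounds, degrees and cliques around edges. -/

section Points

/-- The binomial generating function; the values 2 and 1/2 of `c` give the upper and lower tails
below by Markov's inequality. -/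
theorem integral_pi_pow_card {ι X : Type*} [Fintype ι] [MeasurableSpace X] (μ : Measure X)
    [IsProbabilityMeasure μ] {B : Set X} [DecidablePred (· ∈ B)] (hB : MeasurableSet B) (c : ℝ) :
    ∫ x, c ^ (Finset.univ.filter fun i => x i ∈ B).card ∂(Measure.pi fun _ : ι => μ) =
      (1 + (c - 1) * μ.real B) ^ Fintype.card ι := by
  have h : ∀ x : ι → X, c ^ (Finset.univ.filter fun i => x i ∈ B).card =
      ∏ i, (1 + (c - 1) * B.indicator 1 (x i)) := by
    intro x
    rw [← Finset.prod_const, Finset.prod_filter]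
    refine Finset.prod_congr rfl fun i _ => ?_
    by_cases hi : x i ∈ B <;> simp [hi]
  simp_rw [h]
  rw [integral_fintype_prod_eq_pow (fun x => 1 + (c - 1) * B.indicator (1 : X → ℝ) x)]
  congr 1
  have hi : Integrable (B.indicator (1 : X → ℝ)) μ :=
    (integrable_const (1 : ℝ)).indicator hB
  rw [integral_add (integrable_const _) (hi.const_mul _), integral_const_mul,
    integral_indicator_one hB]
  simp

theorem integrable_pi_pow_card {ι X : Type*} [Fintype ι] [MeasurableSpace X] (μ : Measure X)
    [IsProbabilityMeasure μ] {B : Set X} [DecidablePred (· ∈ B)] (hB : MeasurableSet B) (c : ℝ) :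
    Integrable (fun x => c ^ (Finset.univ.filter fun i => x i ∈ B).card)
      (Measure.pi fun _ : ι => μ) := by
  have h : (fun x : ι → X => c ^ (Finset.univ.filter fun i => x i ∈ B).card) =
      fun x => ∏ i, (1 + (c - 1) * B.indicator (1 : X → ℝ) (x i)) := by
    funext x
    rw [← Finset.prod_const, Finset.prod_filter]
    refine Finset.prod_congr rfl fun i _ => ?_
    by_cases hi : x i ∈ B <;> simp [hi]
  rw [h]
  refine Integrable.fintype_prod (μ := fun _ : ι => μ)
    (f := fun _ x => 1 + (c - 1) * B.indicator (1 : X → ℝ) x) fun i => ?_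
  exact (integrable_const _).add (((integrable_const (1 : ℝ)).indicator hB).const_mul _)

theorem pi_real_le_card_le {ι X : Type*} [Fintype ι] [MeasurableSpace X] (μ : Measure X)
    [IsProbabilityMeasure μ] {B : Set X} [DecidablePred (· ∈ B)] (hB : MeasurableSet B) (M : ℝ) :
    (Measure.pi fun _ : ι => μ).real {x | M ≤ (Finset.univ.filter fun i => x i ∈ B).card} ≤
      (2 : ℝ) ^ (-M) * Real.exp (Fintype.card ι * μ.real B) := by
  have h := mul_meas_ge_le_integral_of_nonneg (μ := Measure.pi fun _ : ι => μ)
    (f := fun x => (2 : ℝ) ^ (Finset.univ.filter fun i => x i ∈ B).card)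
    (ae_of_all _ fun x => by positivity) (integrable_pi_pow_card μ hB 2) ((2 : ℝ) ^ M)
  rw [integral_pi_pow_card μ hB] at h
  have hset : {x : ι → X | M ≤ (Finset.univ.filter fun i => x i ∈ B).card} =
      {x | (2 : ℝ) ^ M ≤ (2 : ℝ) ^ (Finset.univ.filter fun i => x i ∈ B).card} := by
    ext x
    simp only [Set.mem_ofPred_eq]
    rw [← Real.rpow_natCast, Real.rpow_le_rpow_left_iff (by norm_num)]
  rw [hset, Real.rpow_neg (by norm_num), ← div_eq_inv_mul, le_div_iff₀' (by positivity)]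
  refine h.trans ?_
  rw [Real.exp_nat_mul]
  have := Real.add_one_le_exp (μ.real B)
  have h0 : 0 ≤ μ.real B := measureReal_nonneg
  gcongr
  linarith

theorem pi_real_card_lt_le {ι X : Type*} [Fintype ι] [MeasurableSpace X] (μ : Measure X)
    [IsProbabilityMeasure μ] {B : Set X} [DecidablePred (· ∈ B)] (hB : MeasurableSet B) (N : ℝ) :
    (Measure.pi fun _ : ι => μ).real {x | ((Finset.univ.filter fun i => x i ∈ B).card : ℝ) < N} ≤
      (2 : ℝ) ^ N * Real.exp (-(Fintype.card ι * μ.real B / 2)) := by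
  have h := mul_meas_ge_le_integral_of_nonneg (μ := Measure.pi fun _ : ι => μ)
    (f := fun x => (1 / 2 : ℝ) ^ (Finset.univ.filter fun i => x i ∈ B).card)
    (ae_of_all _ fun x => by positivity) (integrable_pi_pow_card μ hB (1 / 2)) ((1 / 2 : ℝ) ^ N)
  rw [integral_pi_pow_card μ hB] at h
  have hset : {x : ι → X | ((Finset.univ.filter fun i => x i ∈ B).card : ℝ) < N} ⊆
      {x | (1 / 2 : ℝ) ^ N ≤ (1 / 2 : ℝ) ^ (Finset.univ.filter fun i => x i ∈ B).card} := by
    intro x hx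
    simp only [Set.mem_ofPred_eq] at hx ⊢
    rw [← Real.rpow_natCast]
    exact Real.rpow_le_rpow_of_exponent_ge (by norm_num) (by norm_num) hx.le
  have e : (2 : ℝ) ^ N = ((1 / 2 : ℝ) ^ N)⁻¹ := by
    rw [one_div, Real.inv_rpow (by norm_num), inv_inv]
  refine (measureReal_mono hset).trans ?_
  rw [e, ← div_eq_inv_mul, le_div_iff₀' (by positivity)]
  refine h.trans ?_
  rw [show -(Fintype.card ι * μ.real B / 2) = Fintype.card ι * (-(μ.real B / 2)) by ring,
    Real.exp_nat_mul]
  have := Real.add_one_le_exp (-(μ.real B / 2))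
  have h1 : μ.real B ≤ 1 := measureReal_le_one
  refine pow_le_pow_left₀ (by linarith) (by linarith) _

/-- Fubini, used as conditioning: the points in `P` are frozen, and the bound is uniform in their
positions. -/
theorem pi_real_le_of_slice {ι X : Type*} [Fintype ι] [MeasurableSpace X]
    (μ : Measure X) [IsProbabilityMeasure μ] (P : ι → Prop) [DecidablePred P] {A : Set (ι → X)}
    (hA : MeasurableSet A) {c : ℝ}
    (h : ∀ y : {i // P i} → X, (Measure.pi fun _ : {i // ¬ P i} => μ).real
      {z | (MeasurableEquiv.piEquivPiSubtypeProd (fun _ => X) P).symm (y, z) ∈ A} ≤ c) :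
    (Measure.pi fun _ : ι => μ).real A ≤ c := by
  have hc : 0 ≤ c := by
    obtain ⟨x⟩ : Nonempty ({i // P i} → X) := by
      have : Nonempty X := nonempty_of_isProbabilityMeasure μ
      infer_instance
    exact measureReal_nonneg.trans (h x)
  have hmp := (measurePreserving_piEquivPiSubtypeProd (fun _ : ι => μ) P).symm
  rw [measureReal_def, ← hmp.measure_preimage hA.nullMeasurableSet,
    Measure.prod_apply (hmp.measurable hA)]
  refine ENNReal.toReal_le_of_le_ofReal hc ?_
  calc _ ≤ ∫⁻ _ : {i // P i} → X, ENNReal.ofReal c ∂(Measure.pi fun _ => μ) := by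
        refine lintegral_mono fun y => ?_
        rw [← ENNReal.toReal_le_toReal (measure_ne_top _ _) ENNReal.ofReal_ne_top,
          ENNReal.toReal_ofReal hc]
        exact h y
    _ = _ := by simp

/-- Conditioning on a quantity with finitely many values, here the true graph, so that coin bounds
on fixed graphs apply; only the fibres of `f` have to be measurable. -/
theorem prod_real_le_of_fiber {Ω Ω' ι : Type*} [MeasurableSpace Ω] [MeasurableSpace Ω'] [Finite ι]
    (μ : Measure Ω) (ν : Measure Ω') [IsProbabilityMeasure μ] [IsProbabilityMeasure ν]
    (f : Ω → ι) (hf : ∀ g, MeasurableSet (f ⁻¹' {g})) (F : ι → Set Ω') {c : ℝ}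
    (h : ∀ g, ν.real (F g) ≤ c) :
    (μ.prod ν).real {ω | ω.2 ∈ F (f ω.1)} ≤ c := by
  have := Fintype.ofFinite ι
  have hsub : {ω : Ω × Ω' | ω.2 ∈ F (f ω.1)} ⊆ ⋃ g, (f ⁻¹' {g}) ×ˢ F g := by
    intro ω hω
    exact Set.mem_iUnion.2 ⟨f ω.1, rfl, hω⟩
  calc _ ≤ (μ.prod ν).real (⋃ g, (f ⁻¹' {g}) ×ˢ F g) := measureReal_mono hsub
    _ ≤ ∑ g, (μ.prod ν).real ((f ⁻¹' {g}) ×ˢ F g) := measureReal_iUnion_fintype_le _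
    _ ≤ ∑ g, μ.real (f ⁻¹' {g}) * c := by
        refine Finset.sum_le_sum fun g _ => ?_
        rw [measureReal_prod_prod]
        exact mul_le_mul_of_nonneg_left (h g) measureReal_nonneg
    _ = c := by
        rw [← Finset.sum_mul, sum_measureReal_preimage_singleton _ fun g _ => hf g]
        simp

theorem IsGeodesicSpace.exists_midpoint {X : Type*} [MetricSpace X] (hX : IsGeodesicSpace X) {x y : X} {r : ℝ}
    (h : dist x y ≤ r) : ∃ m, dist x m ≤ r / 2 ∧ dist y m ≤ r / 2 := by
  obtain ⟨γ, h0, h1, hγ⟩ := hX x y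
  have hd : 0 ≤ dist x y := dist_nonneg
  have hm : dist x y / 2 ∈ Set.Icc 0 (dist x y) := ⟨by linarith, by linarith⟩
  refine ⟨γ (dist x y / 2), ?_, ?_⟩
  · have := hγ 0 ⟨le_rfl, hd⟩ _ hm
    rw [h0] at this
    rw [this, zero_sub, abs_neg, abs_of_nonneg hm.1]
    linarith
  · have := hγ (dist x y) ⟨hd, le_rfl⟩ _ hm
    rw [h1] at this
    rw [this, abs_of_nonneg (by linarith [hm.2])]
    linarith

variable {X : Type*} [MetricSpace X] [MeasurableSpace X] [BorelSpace X]

theorem measurableSet_geometricGraph [SecondCountableTopology X] {V : Type*} [Fintype V] (r : ℝ)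
    (Q : SimpleGraph V → Prop) : MeasurableSet {x : V → X | Q (geometricGraph r x)} := by
  have hG : ∀ G : SimpleGraph V, MeasurableSet {x : V → X | geometricGraph r x = G} := by
    intro G
    have : {x : V → X | geometricGraph r x = G} =
        ⋂ i, ⋂ j, {x | (i ≠ j ∧ dist (x i) (x j) ≤ r) ↔ G.Adj i j} := by
      ext x
      simp only [Set.mem_ofPred_eq, Set.mem_iInter, SimpleGraph.ext_iff, funext_iff, eq_iff_iff,
        geometricGraph]
    rw [this]
    refine MeasurableSet.iInter fun i => MeasurableSet.iInter fun j => ?_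
    have hd : MeasurableSet {x : V → X | i ≠ j ∧ dist (x i) (x j) ≤ r} := by
      refine (MeasurableSet.const _).inter ?_
      exact measurableSet_le ((measurable_pi_apply i).dist (measurable_pi_apply j))
        measurable_const
    by_cases h : G.Adj i j
    · simpa only [h, iff_true] using hd
    · simp only [h, iff_false]
      exact hd.compl
  have : {x : V → X | Q (geometricGraph r x)} =
      ⋃ G ∈ {G : SimpleGraph V | Q G}, {x | geometricGraph r x = G} := by
    ext x; simp
  rw [this]
  exact MeasurableSet.biUnion (Set.to_countable _) fun G _ => hG G

theorem pi_real_lt_card_closedNbrs_le [SecondCountableTopology X] (μ : Measure X)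
    [IsProbabilityMeasure μ] {V : Type*} [Fintype V] (r b M : ℝ)
    (hb : ∀ x, μ.real (Metric.closedBall x r) ≤ b) :
    (Measure.pi fun _ : V => μ).real
      {x | ∃ i, M < (closedNbrs (geometricGraph r x) i).card} ≤
        Fintype.card V * ((2 : ℝ) ^ (1 - M) * Real.exp (Fintype.card V * b)) := by
  classical
  have hset : {x : V → X | ∃ i, M < (closedNbrs (geometricGraph r x) i).card} =
      {x | ∃ i ∈ (Finset.univ : Finset V),
        x ∈ {x : V → X | M < (closedNbrs (geometricGraph r x) i).card}} := by
    ext x; simp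
  rw [hset]
  refine measureReal_exists_mem_le _ _
    (fun i => {x : V → X | M < (closedNbrs (geometricGraph r x) i).card}) fun i _ => ?_
  refine pi_real_le_of_slice μ (fun w => w = i)
    (measurableSet_geometricGraph r fun G => M < (closedNbrs G i).card) fun y => ?_
  set B := Metric.closedBall (y ⟨i, rfl⟩) r with hB
  -- The closed neighbourhood counts `i` itself, so the threshold for the other points drops by one.
  refine (measureReal_mono (s₂ := {z : {w // ¬ w = i} → X | M - 1 ≤
    (Finset.univ.filter fun w => z w ∈ B).card}) ?_).trans
    ((pi_real_le_card_le μ Metric.isClosed_closedBall.measurableSet (M - 1)).trans ?_)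
  · intro z hz
    simp only [Set.mem_ofPred_eq] at hz ⊢
    set x := (MeasurableEquiv.piEquivPiSubtypeProd (fun _ : V => X) fun w => w = i).symm (y, z)
      with hx
    have hxi : x i = y ⟨i, rfl⟩ := by
      simp [hx, MeasurableEquiv.piEquivPiSubtypeProd, Equiv.piEquivPiSubtypeProd]
    have hxw : ∀ w (hw : ¬ w = i), x w = z ⟨w, hw⟩ := by
      intro w hw
      simp [hx, MeasurableEquiv.piEquivPiSubtypeProd, Equiv.piEquivPiSubtypeProd, hw]
    have hsub : closedNbrs (geometricGraph r x) i ⊆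
        insert i ((Finset.univ.filter fun w => z w ∈ B).map (Function.Embedding.subtype _)) := by
      intro w hw
      rw [mem_closedNbrs] at hw
      by_cases hwi : w = i
      · simp [hwi]
      · have hd := (hw.resolve_left hwi).2
        rw [Finset.mem_insert, Finset.mem_map]
        refine Or.inr ⟨⟨w, hwi⟩, ?_, rfl⟩
        rw [hxi, hxw w hwi, dist_comm] at hd
        simpa [hB] using hd
    have := (Finset.card_le_card hsub).trans (Finset.card_insert_le _ _)
    rw [Finset.card_map] at this
    have h2 : ((closedNbrs (geometricGraph r x) i).card : ℝ) ≤
      (Finset.univ.filter fun w => z w ∈ B).card + 1 := by exact_mod_cast this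
    linarith
  · rw [neg_sub]
    have h0 : 0 ≤ μ.real B := measureReal_nonneg
    have hc : (Fintype.card {w // ¬ w = i} : ℝ) ≤ Fintype.card V := by
      exact_mod_cast Fintype.card_subtype_le _
    gcongr
    exact hb _

/-- With `u` and `v` frozen, the midpoint ball of radius `r/2` is fixed. It holds at least `N` of
the remaining points unless a lower tail event occurs, and any two points in it are within `r`. -/
theorem pi_real_not_edgesInCliques_le [SecondCountableTopology X] (hX : IsGeodesicSpace X)
    (μ : Measure X) [IsProbabilityMeasure μ] {V : Type*} [Fintype V] (r s N : ℝ)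
    (hs : ∀ x, s ≤ μ.real (Metric.closedBall x (r / 2))) (hs0 : 0 ≤ s) :
    (Measure.pi fun _ : V => μ).real
      {x | ¬ EdgesInCliques (geometricGraph r x) N} ≤
        (Fintype.card V : ℝ) ^ 2 *
          ((2 : ℝ) ^ N * Real.exp (-((Fintype.card V - 2) * s / 2))) := by
  classical
  set Q : V × V → SimpleGraph V → Prop := fun c G => G.Adj c.1 c.2 ∧
    ¬ ∃ U : Finset V, c.1 ∉ U ∧ c.2 ∉ U ∧ N ≤ U.card ∧
      G.IsClique (insert c.1 (insert c.2 U) : Finset V) with hQ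
  have hset : {x : V → X | ¬ EdgesInCliques (geometricGraph r x) N} ⊆
      {x | ∃ c ∈ (Finset.univ : Finset (V × V)),
        x ∈ {x : V → X | Q c (geometricGraph r x)}} := by
    intro x hx
    simp only [Set.mem_ofPred_eq, EdgesInCliques] at hx
    push Not at hx
    obtain ⟨u, v, huv, h⟩ := hx
    refine ⟨(u, v), Finset.mem_univ _, huv, ?_⟩
    rintro ⟨U, h1, h2, h3, h4⟩
    exact h U h1 h2 h3 h4
  have h4 : ((Finset.univ : Finset (V × V)).card : ℝ) = (Fintype.card V : ℝ) ^ 2 := by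
    rw [Finset.card_univ, Fintype.card_prod]; push_cast; ring
  refine (measureReal_mono hset).trans ?_
  rw [← h4]
  refine measureReal_exists_mem_le _ _
    (fun c => {x : V → X | Q c (geometricGraph r x)}) ?_
  rintro ⟨u, v⟩ -
  refine pi_real_le_of_slice μ (fun w => w = u ∨ w = v)
    (measurableSet_geometricGraph r (Q (u, v))) fun y => ?_
  set a := y ⟨u, Or.inl rfl⟩ with ha
  set b := y ⟨v, Or.inr rfl⟩ with hb
  set e := MeasurableEquiv.piEquivPiSubtypeProd (fun _ : V => X) fun w => w = u ∨ w = v with he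
  have hxu : ∀ z, e.symm (y, z) u = a := by
    intro z
    simp [he, ha, MeasurableEquiv.piEquivPiSubtypeProd, Equiv.piEquivPiSubtypeProd]
  have hxv : ∀ z, e.symm (y, z) v = b := by
    intro z
    simp [he, hb, MeasurableEquiv.piEquivPiSubtypeProd, Equiv.piEquivPiSubtypeProd]
  have hxw : ∀ z w (hw : ¬ (w = u ∨ w = v)), e.symm (y, z) w = z ⟨w, hw⟩ := by
    intro z w hw
    simp [he, MeasurableEquiv.piEquivPiSubtypeProd, Equiv.piEquivPiSubtypeProd, hw]
  by_cases hab : dist a b ≤ r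
  swap
  · have : {z | e.symm (y, z) ∈ {x : V → X | Q (u, v) (geometricGraph r x)}} = ∅ := by
      ext z
      simp only [Set.mem_ofPred_eq, hQ, Set.mem_empty_iff_false, iff_false, not_and]
      intro h
      have := h.2
      simp only [hxu, hxv] at this
      exact absurd this hab
    rw [this, measureReal_empty]
    positivity
  obtain ⟨m, hma, hmb⟩ := hX.exists_midpoint hab
  set B := Metric.closedBall m (r / 2) with hB
  refine (measureReal_mono (s₂ := {z : {w // ¬ (w = u ∨ w = v)} → X |
    ((Finset.univ.filter fun w => z w ∈ B).card : ℝ) < N}) ?_).trans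
    ((pi_real_card_lt_le μ Metric.isClosed_closedBall.measurableSet N).trans ?_)
  · intro z hz
    simp only [Set.mem_ofPred_eq, hQ] at hz ⊢
    by_contra! hN
    refine hz.2 ⟨(Finset.univ.filter fun w => z w ∈ B).map (Function.Embedding.subtype _),
      ?_, ?_, ?_, ?_⟩
    · simp
    · simp
    · rwa [Finset.card_map]
    · have hball : ∀ w ∈ insert u (insert v ((Finset.univ.filter fun w => z w ∈ B).map
          (Function.Embedding.subtype _))), dist (e.symm (y, z) w) m ≤ r / 2 := by
        intro w hw
        rw [Finset.mem_insert, Finset.mem_insert, Finset.mem_map] at hw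
        rcases hw with rfl | rfl | ⟨w', hw', rfl⟩
        · rwa [hxu]
        · rwa [hxv]
        · rw [Function.Embedding.subtype_apply, hxw z w' w'.2]
          simpa [hB] using hw'
      intro w hw w' hw' hne
      refine ⟨hne, (dist_triangle_right _ _ m).trans ?_⟩
      have h1 := hball w (by exact_mod_cast hw)
      have h2 := hball w' (by exact_mod_cast hw')
      linarith
  · have hc : (Fintype.card V : ℝ) - 2 ≤ Fintype.card {w // ¬ (w = u ∨ w = v)} := by
      have h1 : Fintype.card {w // w = u ∨ w = v} ≤ 2 := by
        rw [Fintype.card_subtype]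
        refine (Finset.card_le_card (t := {u, v}) ?_).trans Finset.card_le_two
        intro w hw
        simpa using hw
      have h2 := Fintype.card_subtype_compl fun w => w = u ∨ w = v
      have h3 : Fintype.card V ≤ Fintype.card {w // ¬ (w = u ∨ w = v)} + 2 := by omega
      have h5 : (Fintype.card V : ℝ) ≤ Fintype.card {w // ¬ (w = u ∨ w = v)} + 2 := by
        exact_mod_cast h3
      linarith
    gcongr
    exact hs m

end Points

/-! ### Numerical estimates and choice of parameters. -/

section Estimates

theorem exists_clique_parameters (p : ℝ) (hp0 : 0 < p) (hp : p < 1 / 1000) :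
    ∀ᶠ y : ℝ in atTop, 2 / 3 * Real.logb (1 / (1 - p)) y ≤ y / 4 ∧
      ∃ k m a P : ℕ, 1 ≤ k ∧ 2 / 3 * Real.logb (1 / (1 - p)) y ≤ k ∧ 2 * (m : ℝ) ≤ y / 4 ∧
        k * (1 / √(1 - p)) ^ k ≤ a ∧ k * (k * P) * a ≤ m ∧
        (16 * p) ^ m + 4 ^ m * (2 / 3 : ℝ) ^ (P ^ 2) ≤ 100 * Real.exp (-(3 / 10 * y)) := by
  have h1p : 0 < 1 - p := by linarith
  set b := 1 / (1 - p) with hb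
  have hb1 : 1 < b := by rw [hb, one_lt_div h1p]; linarith
  have hb2 : b ≤ 2 := by rw [hb, div_le_iff₀ h1p]; linarith
  have hlogb : 0 < Real.log b := Real.log_pos hb1
  have hlog : ∀ᶠ y : ℝ in atTop, ‖Real.log y‖ ≤ Real.log b / 2 * ‖y ^ (1 / 60 : ℝ)‖ :=
    (isLittleO_log_rpow_atTop (by norm_num)).bound (by positivity)
  have hw : ∀ᶠ y : ℝ in atTop, 10 ≤ y ^ (1 / 60 : ℝ) :=
    (tendsto_rpow_atTop (by norm_num)).eventually_ge_atTop 10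
  filter_upwards [hlog, hw, eventually_ge_atTop 1] with y hly hwy hy1
  have hy0 : 0 < y := by linarith
  -- A small power of `y` that absorbs logarithms and constants: `k ≤ w` and `a ≤ 3 w^21`, so `k² a
  -- ≤ w^24` and `P ≥ w^35`, whose square exceeds `y = w^60`.
  set w := y ^ (1 / 60 : ℝ) with hwdef
  have hw0 : 0 < w := by linarith
  have hyw : y = w ^ 60 := by
    rw [hwdef, ← Real.rpow_natCast, ← Real.rpow_mul hy0.le]; norm_num
  rw [Real.norm_of_nonneg (Real.log_nonneg hy1), Real.norm_of_nonneg hw0.le] at hly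
  have hl0 : 0 ≤ Real.logb b y := Real.logb_nonneg hb1 hy1
  have hl : Real.logb b y ≤ w / 2 := by
    rw [Real.logb, div_le_iff₀ hlogb]; linarith
  set k := ⌈2 / 3 * Real.logb b y⌉₊ + 1 with hk
  have hkge : 2 / 3 * Real.logb b y ≤ k := by
    rw [hk]; push_cast
    linarith [Nat.le_ceil (2 / 3 * Real.logb b y)]
  have hkle : (k : ℝ) ≤ 2 / 3 * Real.logb b y + 2 := by
    rw [hk]; push_cast
    linarith [Nat.ceil_lt_add_one (show 0 ≤ 2 / 3 * Real.logb b y by positivity)]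
  have hk1 : 1 ≤ k := by omega
  have hk1' : (1 : ℝ) ≤ k := by exact_mod_cast hk1
  have hkw : (k : ℝ) ≤ w := by linarith
  have hwy' : 2 * w ≤ y := by
    calc 2 * w ≤ w * w := by gcongr; linarith
      _ = w ^ 2 := by ring
      _ ≤ w ^ 60 := pow_le_pow_right₀ (by linarith) (by norm_num)
      _ = y := hyw.symm
  have hsqrt : 1 / √(1 - p) = b ^ (1 / 2 : ℝ) := by
    rw [← Real.sqrt_eq_rpow, hb, Real.sqrt_div (by norm_num), Real.sqrt_one]
  have hbk : (1 / √(1 - p)) ^ k ≤ 2 * w ^ 20 := by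
    rw [hsqrt, ← Real.rpow_natCast, ← Real.rpow_mul (by linarith)]
    calc b ^ (1 / 2 * (k : ℝ)) ≤ b ^ (Real.logb b y * (1 / 3) + 1) :=
          Real.rpow_le_rpow_of_exponent_le hb1.le (by linarith)
      _ = y ^ (1 / 3 : ℝ) * b := by
          rw [Real.rpow_add (by linarith), Real.rpow_mul (by linarith),
            Real.rpow_logb (by linarith) hb1.ne' hy0, Real.rpow_one]
      _ = w ^ 20 * b := by
          congr 1
          rw [hwdef, ← Real.rpow_natCast, ← Real.rpow_mul hy0.le]; norm_num
      _ ≤ 2 * w ^ 20 := by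
          rw [mul_comm]; gcongr
  set a := ⌈(k : ℝ) * (2 * w ^ 20)⌉₊ with ha
  have hage : (k : ℝ) * (2 * w ^ 20) ≤ a := Nat.le_ceil _
  have hale : (a : ℝ) ≤ k * (2 * w ^ 20) + 1 := (Nat.ceil_lt_add_one (by positivity)).le
  have hw20 : (1 : ℝ) ≤ w ^ 20 := one_le_pow₀ (by linarith)
  have hapos : (0 : ℝ) < a := lt_of_lt_of_le (by positivity) hage
  have hD : (k : ℝ) * k * a ≤ w ^ 24 := by
    have h1 : (a : ℝ) ≤ 3 * w ^ 21 := by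
      have : (k : ℝ) * (2 * w ^ 20) ≤ w * (2 * w ^ 20) := by gcongr
      have h21 : (1 : ℝ) ≤ w ^ 21 := one_le_pow₀ (by linarith)
      have e : w * (2 * w ^ 20) = 2 * w ^ 21 := by ring
      linarith
    calc (k : ℝ) * k * a ≤ w * w * (3 * w ^ 21) := by gcongr
      _ = 3 * w ^ 23 := by ring
      _ ≤ w * w ^ 23 := by gcongr; linarith
      _ = w ^ 24 := by ring
  set m := ⌊y / 8⌋₊ with hm
  have hmle : (m : ℝ) ≤ y / 8 := Nat.floor_le (by positivity)
  have hmge : y / 8 - 1 ≤ m := (Nat.sub_one_lt_floor _).le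
  set P := m / (k * k * a) with hP
  have hPge : w ^ 35 ≤ P := by
    have hDpos : 0 < k * k * a := by
      have : 0 < a := by exact_mod_cast hapos
      positivity
    have h1 : m < k * k * a * (P + 1) := by
      rw [hP]; exact Nat.lt_mul_div_succ m hDpos
    have h2 : (m : ℝ) < k * k * a * (P + 1) := by exact_mod_cast h1
    have h3 : (m : ℝ) < w ^ 24 * (P + 1) := lt_of_lt_of_le h2 (by gcongr)
    have h4 : w ^ 60 / 8 - 1 < w ^ 24 * (P + 1) := by rw [← hyw]; linarith
    by_contra! hlt
    have h5 : w ^ 24 * ((P : ℝ) + 1) ≤ w ^ 24 * (w ^ 35 + 1) := by gcongr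
    have h6 : w ^ 24 ≤ w ^ 59 := pow_le_pow_right₀ (by linarith) (by norm_num)
    have h7 : (10 : ℝ) * w ^ 59 ≤ w ^ 60 := by
      rw [pow_succ' w 59]; gcongr
    have h8 : (1 : ℝ) ≤ w ^ 24 := one_le_pow₀ (by linarith)
    have h9 : w ^ 24 * (w ^ 35 + 1) = w ^ 59 + w ^ 24 := by ring
    have h10 : w ^ 24 * 100 ≤ w ^ 59 := by
      calc w ^ 24 * 100 ≤ w ^ 24 * w ^ 35 := by
            gcongr
            calc (100 : ℝ) = 10 ^ 2 := by norm_num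
              _ ≤ w ^ 2 := by gcongr
              _ ≤ w ^ 35 := pow_le_pow_right₀ (by linarith) (by norm_num)
        _ = w ^ 59 := by ring
    linarith
  -- Enough to beat the union bound: `(2/3)^(P²) ≤ exp(-5y/3)`, while `4^m ≤ exp(y/4)`.
  have hP2 : 5 * y ≤ (P : ℝ) ^ 2 := by
    calc 5 * y ≤ w ^ 10 * w ^ 60 := by
          rw [← hyw]
          gcongr
          calc (5 : ℝ) ≤ w := by linarith
            _ ≤ w ^ 10 := le_self_pow₀ (by linarith) (by norm_num)
      _ = (w ^ 35) ^ 2 := by ring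
      _ ≤ (P : ℝ) ^ 2 := by gcongr
  refine ⟨by linarith, k, m, a, P, hk1, hkge, by linarith, ?_, ?_, ?_⟩
  · refine le_trans ?_ hage
    gcongr
  · calc k * (k * P) * a = m / (k * k * a) * (k * k * a) := by rw [hP]; ring
      _ ≤ m := Nat.div_mul_le_self _ _
  · have he1 : Real.exp 1 < 2.7182818286 := Real.exp_one_lt_d9
    have he1' : 2.7182818283 < Real.exp 1 := Real.exp_one_gt_d9
    have he4 : Real.exp 4 ≤ 60 := by
      rw [show (4 : ℝ) = ((4 : ℕ) : ℝ) * 1 by norm_num, Real.exp_nat_mul]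
      calc Real.exp 1 ^ 4 ≤ 2.7182818286 ^ 4 := by gcongr
        _ ≤ 60 := by norm_num
    have hfirst : (16 * p) ^ m ≤ 60 * Real.exp (-(3 / 10 * y)) := by
      -- This is where `p < 1/1000` is needed; since `m ≥ y/8 - 1`, the power decays like `exp(4 -
      -- y/2)`.
      have hb : 16 * p ≤ Real.exp (-4) := by
        rw [Real.exp_neg]
        calc 16 * p ≤ 60⁻¹ := by linarith
          _ ≤ _ := by gcongr
      calc (16 * p) ^ m ≤ Real.exp (-4) ^ m := by gcongr
        _ = Real.exp (m * (-4)) := by rw [← Real.exp_nat_mul]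
        _ ≤ Real.exp (4 + -(3 / 10 * y)) := by gcongr; linarith
        _ = Real.exp 4 * Real.exp (-(3 / 10 * y)) := Real.exp_add _ _
        _ ≤ _ := by gcongr
    have hsecond : 4 ^ m * (2 / 3 : ℝ) ^ (P ^ 2) ≤ Real.exp (-(3 / 10 * y)) := by
      have h4 : (4 : ℝ) ≤ Real.exp 2 := by
        rw [show (2 : ℝ) = ((2 : ℕ) : ℝ) * 1 by norm_num, Real.exp_nat_mul]
        calc (4 : ℝ) ≤ 2.7182818283 ^ 2 := by norm_num
          _ ≤ _ := by gcongr
      have h23 : (2 / 3 : ℝ) ≤ Real.exp (-(1 / 3)) := by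
        linarith [Real.add_one_le_exp (-(1 / 3) : ℝ)]
      calc 4 ^ m * (2 / 3 : ℝ) ^ (P ^ 2) ≤ Real.exp 2 ^ m * Real.exp (-(1 / 3)) ^ (P ^ 2) := by
            gcongr
        _ = Real.exp (m * 2 + ((P ^ 2 : ℕ) : ℝ) * (-(1 / 3))) := by
            rw [← Real.exp_nat_mul, ← Real.exp_nat_mul, Real.exp_add]
        _ ≤ _ := by
            gcongr
            push_cast
            linarith
    have : 0 < Real.exp (-(3 / 10 * y)) := Real.exp_pos _
    linarith

/-- From `j! ≥ (j/3)^j` the left side is at most `(3Mq/j)^j`. -/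
theorem choose_mul_pow_le {M : ℕ} {j : ℕ} {q D : ℝ} (hj : 1 ≤ j) (hq : 0 ≤ q)
    (h : 3 * (M * q) ≤ D * j) : M.choose j * q ^ j ≤ D ^ j := by
  have hj0 : (0 : ℝ) < j := by exact_mod_cast hj
  have hf : (0 : ℝ) < j.factorial := by exact_mod_cast j.factorial_pos
  have h1 : (j : ℝ) ^ j ≤ j.factorial * 3 ^ j := by
    have := Real.pow_div_factorial_le_exp (j : ℝ) hj0.le j
    rw [div_le_iff₀ hf] at this
    refine this.trans ?_
    rw [mul_comm]
    gcongr
    rw [← mul_one (j : ℝ), Real.exp_nat_mul]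
    gcongr
    linarith [Real.exp_one_lt_d9]
  calc M.choose j * q ^ j ≤ (M : ℝ) ^ j / j.factorial * q ^ j := by
        gcongr
        exact Nat.choose_le_pow_div j M
    _ = (M * q) ^ j / j.factorial := by rw [mul_pow]; ring
    _ ≤ (M * q) ^ j * (3 ^ j / (j : ℝ) ^ j) := by
        rw [div_eq_mul_one_div]
        refine mul_le_mul_of_nonneg_left ?_ (by positivity)
        rw [div_le_div_iff₀ hf (by positivity)]
        linarith
    _ = (3 * (M * q) / j) ^ j := by rw [← mul_div_assoc, div_pow, mul_pow 3]; ring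
    _ ≤ D ^ j := by
        gcongr
        rw [div_le_iff₀ hj0]; exact h

theorem inv_rpow_pow_le {n : ℕ} (hn : 1 ≤ n) {τ : ℝ} (hτ : 0 < τ) {l i : ℕ}
    (h : i * τ ≤ 16 * l) : ((1 / (n : ℝ)) ^ (16 / τ)) ^ l ≤ (1 / (n : ℝ)) ^ i := by
  have hn0 : (0 : ℝ) < n := by exact_mod_cast hn
  rw [← Real.rpow_natCast, ← Real.rpow_natCast, ← Real.rpow_mul (by positivity)]
  refine Real.rpow_le_rpow_of_exponent_ge (by positivity) ?_ ?_
  · rw [div_le_one hn0]; exact_mod_cast hn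
  · rw [div_mul_eq_mul_div, le_div_iff₀ hτ]; exact h

/-- With `z = n^{-16/τ}`, the bound on `c` gives `3Mq ≤ z j`. As `j ≥ τ/4` and `l ≥ kτ/4`, the
exponent 16 turns `z^j` and `z^l` into `n^{-4}` and `n^{-4k}`, which absorb the counts `n²` and
`n^k`. -/
theorem insertion_bound_le {n M k j l : ℕ} {τ y C c q : ℝ} (hn : 1 ≤ n) (hτ : 0 < τ)
    (hk : k = max 2 ⌈τ⌉₊) (hj : j = (k + 3) / 4) (hl : l = (k * k + 3) / 4)
    (hC : 1 ≤ C) (hM : (M : ℝ) ≤ C * y) (hτy : τ ≤ y / 4) (hc0 : 0 < c) (hc : c ≤ 1 / (12 * C))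
    (hq0 : 0 ≤ q) (hq : q ≤ c * (1 / (n : ℝ)) ^ (16 / τ) * (τ / y)) :
    (n : ℝ) ^ 2 * (M.choose j * q ^ j) + (n : ℝ) ^ k * q ^ l ≤ 2 / (n : ℝ) := by
  have hn0 : (0 : ℝ) < n := by exact_mod_cast hn
  have hn1 : 1 / (n : ℝ) ≤ 1 := by rw [div_le_one hn0]; exact_mod_cast hn
  have hy : 0 < y := by linarith
  set z := (1 / (n : ℝ)) ^ (16 / τ) with hz
  have hz0 : 0 ≤ z := by positivity
  have hkτ : τ ≤ k := by
    rw [hk]; push_cast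
    exact le_max_of_le_right (Nat.le_ceil τ)
  have hk2 : 2 ≤ k := by omega
  have hj4 : (k : ℝ) ≤ 4 * j := by
    have : k ≤ 4 * j := by omega
    exact_mod_cast this
  have hl4 : (k : ℝ) * k ≤ 4 * l := by
    have : k * k ≤ 4 * l := by omega
    exact_mod_cast this
  have hcC : c * (12 * C) ≤ 1 := by
    rwa [le_div_iff₀ (by positivity)] at hc
  have hqz : q ≤ z := by
    refine hq.trans ?_
    have h1 : τ / y ≤ 1 := by rw [div_le_one hy]; linarith
    have h2 : c ≤ 1 := by nlinarith
    calc c * z * (τ / y) ≤ 1 * z * 1 := by gcongr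
      _ = z := by ring
  have hA : M.choose j * q ^ j ≤ z ^ j := by
    refine choose_mul_pow_le (by omega) hq0 ?_
    calc 3 * (M * q) ≤ 3 * (C * y * (c * z * (τ / y))) := by gcongr
      _ = c * (12 * C) * z * (τ / 4) := by field_simp; ring
      _ ≤ 1 * z * j := by
        gcongr
        linarith
      _ = z * j := by ring
  have hz4 : z ^ j ≤ (1 / (n : ℝ)) ^ 4 := inv_rpow_pow_le hn hτ (by push_cast; linarith)
  have hzl : z ^ l ≤ (1 / (n : ℝ)) ^ (4 * k) := by
    refine inv_rpow_pow_le hn hτ ?_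
    push_cast
    have : (k : ℝ) * τ ≤ k * k := by gcongr
    linarith
  have e1 : (n : ℝ) ^ 2 * (1 / (n : ℝ)) ^ 4 ≤ 1 / (n : ℝ) := by
    calc (n : ℝ) ^ 2 * (1 / (n : ℝ)) ^ 4 = (1 / (n : ℝ)) ^ 2 := by field_simp
      _ ≤ (1 / (n : ℝ)) ^ 1 := pow_le_pow_of_le_one (by positivity) hn1 (by norm_num)
      _ = 1 / (n : ℝ) := pow_one _
  have e2 : (n : ℝ) ^ k * (1 / (n : ℝ)) ^ (4 * k) ≤ 1 / (n : ℝ) := by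
    calc (n : ℝ) ^ k * (1 / (n : ℝ)) ^ (4 * k) = (1 / (n : ℝ)) ^ (3 * k) := by
          rw [show 4 * k = k + 3 * k by ring, pow_add, ← mul_assoc, ← mul_pow,
            mul_one_div_cancel hn0.ne', one_pow, one_mul]
      _ ≤ (1 / (n : ℝ)) ^ 1 := pow_le_pow_of_le_one (by positivity) hn1 (by omega)
      _ = 1 / (n : ℝ) := pow_one _
  calc (n : ℝ) ^ 2 * (M.choose j * q ^ j) + (n : ℝ) ^ k * q ^ l
      ≤ (n : ℝ) ^ 2 * (1 / (n : ℝ)) ^ 4 + (n : ℝ) ^ k * (1 / (n : ℝ)) ^ (4 * k) := by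
        gcongr
        · exact hA.trans hz4
        · exact (pow_le_pow_left₀ hq0 hqz l).trans hzl
    _ ≤ 1 / (n : ℝ) + 1 / (n : ℝ) := add_le_add e1 e2
    _ = 2 / (n : ℝ) := by ring

theorem sq_mul_exp_le {n : ℕ} (hn : 1 ≤ n) {y : ℝ} (hy : 13 * Real.log n ≤ y) :
    (n : ℝ) ^ 2 * Real.exp (-(3 / 10 * y)) ≤ 1 / (n : ℝ) := by
  have hn0 : (0 : ℝ) < n := by exact_mod_cast hn
  have hlog : 0 ≤ Real.log n := Real.log_nonneg (by exact_mod_cast hn)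
  have h : Real.exp (-(3 / 10 * y)) ≤ ((n : ℝ) ^ 3)⁻¹ := by
    rw [Real.exp_neg]
    gcongr
    calc (n : ℝ) ^ 3 = Real.exp (Real.log n) ^ 3 := by rw [Real.exp_log hn0]
      _ = Real.exp ((3 : ℕ) * Real.log n) := by rw [← Real.exp_nat_mul]
      _ ≤ _ := Real.exp_le_exp.2 (by push_cast; linarith)
  calc (n : ℝ) ^ 2 * Real.exp (-(3 / 10 * y))
      ≤ (n : ℝ) ^ 2 * ((n : ℝ) ^ 3)⁻¹ := by gcongr
    _ = 1 / (n : ℝ) := by field_simp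

/-- Both tails decay at rate at least 3/10 in `y`: for the lower one `1/2 - (log 2)/4 > 3/10`, and
the two frozen points cost a factor `e^s ≤ 3`. As `13 · 3/10 > 3`, this beats `n²`. -/
theorem points_bound_le {n : ℕ} (hn : 1 ≤ n) {s A : ℝ} (hA : 0 ≤ A)
    (hs1 : s ≤ 1) (hy : 13 * Real.log n ≤ s * n) :
    (n : ℝ) * ((2 : ℝ) ^ (1 - (2 * A + 2) * (s * n)) * Real.exp (n * (A * s))) +
      (n : ℝ) ^ 2 * ((2 : ℝ) ^ (s * n / 4) * Real.exp (-((n - 2) * s / 2))) ≤ 5 / (n : ℝ) := by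
  have hn0 : (0 : ℝ) < n := by exact_mod_cast hn
  have hn1 : (1 : ℝ) ≤ n := by exact_mod_cast hn
  have hlog : 0 ≤ Real.log n := Real.log_nonneg hn1
  set y := s * n with hydef
  have hy0 : 0 ≤ y := by linarith
  have hl2 : 0.69 < Real.log 2 := by linarith [Real.log_two_gt_d9]
  have hl2' : Real.log 2 < 0.694 := by linarith [Real.log_two_lt_d9]
  have hrpow : ∀ x : ℝ, (2 : ℝ) ^ x = Real.exp (Real.log 2 * x) := fun x =>
    Real.rpow_def_of_pos (by norm_num) x
  have hmain := sq_mul_exp_le hn hy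
  have h1 : (2 : ℝ) ^ (1 - (2 * A + 2) * y) * Real.exp (n * (A * s)) ≤
      2 * Real.exp (-(3 / 10 * y)) := by
    rw [sub_eq_add_neg, Real.rpow_add (by norm_num), Real.rpow_one, mul_assoc, hrpow,
      ← Real.exp_add]
    gcongr
    have e : (n : ℝ) * (A * s) = A * y := by rw [hydef]; ring
    have hAy : 0 ≤ A * y := by positivity
    rw [e]
    nlinarith
  have h2 : (2 : ℝ) ^ (y / 4) * Real.exp (-((n - 2) * s / 2)) ≤
      3 * Real.exp (-(3 / 10 * y)) := by
    rw [hrpow, ← Real.exp_add]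
    calc _ ≤ Real.exp (1 + -(3 / 10 * y)) := by
          refine Real.exp_le_exp.2 ?_
          have e : ((n : ℝ) - 2) * s / 2 = y / 2 - s := by rw [hydef]; ring
          rw [e]
          nlinarith
      _ = Real.exp 1 * Real.exp (-(3 / 10 * y)) := Real.exp_add _ _
      _ ≤ _ := by
          gcongr
          linarith [Real.exp_one_lt_d9]
  have h3 : (n : ℝ) ≤ (n : ℝ) ^ 2 := by nlinarith
  calc _ ≤ (n : ℝ) ^ 2 * (2 * Real.exp (-(3 / 10 * y))) +
        (n : ℝ) ^ 2 * (3 * Real.exp (-(3 / 10 * y))) := by gcongr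
    _ = 5 * ((n : ℝ) ^ 2 * Real.exp (-(3 / 10 * y))) := by ring
    _ ≤ 5 * (1 / (n : ℝ)) := by gcongr
    _ = 5 / (n : ℝ) := by ring

end Estimates

/-! ### Combining points and coins; passage to the limit. -/

section Assembly

theorem IsDoublingMeasure.real_closedBall_le {X : Type*} [MetricSpace X] [MeasurableSpace X]
    {μ : Measure X} [IsProbabilityMeasure μ]
    {L r b : ℝ}
    (hμ : IsDoublingMeasure μ L) (hr : 0 < r) (x : X)
    (hb : μ.real (Metric.closedBall x (r / 2)) ≤ b) :
    μ.real (Metric.closedBall x r) ≤ |L| * b := by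
  have h := (hμ x (r / 2) (by positivity)).2.2
  rw [mul_div_cancel₀ _ two_ne_zero] at h
  have h' := ENNReal.toReal_mono (by finiteness) h
  rw [ENNReal.toReal_mul, ENNReal.toReal_ofReal', ← measureReal_def, ← measureReal_def] at h'
  refine h'.trans ?_
  have h0 : 0 ≤ μ.real (Metric.closedBall x (r / 2)) := measureReal_nonneg
  gcongr
  exact max_le (le_abs_self L) (abs_nonneg L)

variable {X : Type*} [MetricSpace X] [MeasurableSpace X] [BorelSpace X]

instance sampleMeasure.isProbabilityMeasure (μ : Measure X) [IsProbabilityMeasure μ] (n : ℕ)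
    (p q : I) : IsProbabilityMeasure (sampleMeasure μ n p q) := by
  unfold sampleMeasure
  infer_instance

theorem sampleMeasure_real_recoveryEvent_ge [SecondCountableTopology X] (μ : Measure X)
    [IsProbabilityMeasure μ] {n k j : ℕ} {r τ ε₀ ε₁ ε₂ : ℝ} {p q : I}
    (Q : SimpleGraph (Fin n) → Prop) (hk : k = max 2 ⌈τ⌉₊) (hj : 4 * j ≤ k + 3)
    (h₀ : (Measure.pi fun _ : Fin n => μ).real {x | ¬ Q (geometricGraph r x)} ≤ ε₀)
    (h₁ : ∀ G, Q G → (Measure.pi fun _ : Sym2 (Fin n) => bernoulliMeasure true false p).real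
      (deletionFailure G τ) ≤ ε₁)
    (h₂ : ∀ G, Q G → (Measure.pi fun _ : Sym2 (Fin n) => bernoulliMeasure true false q).real
      (insertionFailure G k j) ≤ ε₂) (hε₁ : 0 ≤ ε₁) (hε₂ : 0 ≤ ε₂) :
    1 - (ε₀ + (ε₁ + ε₂)) ≤ (sampleMeasure μ n p q).real (recoveryEvent X n r τ) := by
  classical
  set coins := (Measure.pi fun _ : Sym2 (Fin n) => bernoulliMeasure true false p).prod
      (Measure.pi fun _ : Sym2 (Fin n) => bernoulliMeasure true false q) with hcoins
  set F : SimpleGraph (Fin n) → Set ((Sym2 (Fin n) → Bool) × (Sym2 (Fin n) → Bool)) :=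
    fun G => if Q G then
      (deletionFailure G τ) ×ˢ Set.univ ∪ Set.univ ×ˢ (insertionFailure G k j) else ∅ with hF
  have hFle : ∀ G, coins.real (F G) ≤ ε₁ + ε₂ := by
    intro G
    by_cases hG : Q G
    · simp only [hF, if_pos hG]
      refine (measureReal_union_le _ _).trans ?_
      rw [hcoins, measureReal_prod_prod, measureReal_prod_prod, probReal_univ, probReal_univ,
        mul_one, one_mul]
      exact add_le_add (h₁ G hG) (h₂ G hG)
    · simp only [hF, if_neg hG, measureReal_empty]
      positivity
  have hcoin : (sampleMeasure μ n p q).real {ω | ω.2 ∈ F (geometricGraph r ω.1)} ≤ ε₁ + ε₂ :=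
    prod_real_le_of_fiber (Measure.pi fun _ : Fin n => μ) coins (geometricGraph r)
      (fun G => measurableSet_geometricGraph r fun H => H = G) F hFle
  have hpts : (sampleMeasure μ n p q).real
      ({x | ¬ Q (geometricGraph r x)} ×ˢ Set.univ) ≤ ε₀ := by
    rw [sampleMeasure, measureReal_prod_prod, probReal_univ, mul_one]
    exact h₀
  -- Covering the whole space and using subadditivity bounds the recovery event from below without
  -- knowing that it is measurable.
  have hsub : (Set.univ : Set (SampleSpace X n)) ⊆ recoveryEvent X n r τ ∪
      ({x | ¬ Q (geometricGraph r x)} ×ˢ Set.univ ∪ {ω | ω.2 ∈ F (geometricGraph r ω.1)}) := by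
    intro ω _
    by_contra hω
    simp only [Set.mem_union, Set.mem_prod, Set.mem_ofPred_eq, Set.mem_univ, and_true, not_or,
      not_not] at hω
    obtain ⟨hrec, hQ, hnF⟩ := hω
    simp only [hF, if_pos hQ, Set.mem_union, Set.mem_prod, Set.mem_univ, and_true, true_and,
      not_or] at hnF
    refine hrec (isMetricApprox_three_of_adj ?_ ?_)
    · intro u v huv
      by_contra h
      exact hnF.1 ⟨u, v, huv, ω.2.2, fun h' => h (h'.trans (by norm_num))⟩
    · intro u v huv
      exact (edist_le_two_of_notMem_insertionFailure hk hj hnF.2 huv).trans (by norm_num)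
  have h := (measureReal_mono (μ := sampleMeasure μ n p q) hsub).trans
    ((measureReal_union_le _ _).trans (add_le_add_right (measureReal_union_le _ _) _))
  rw [probReal_univ] at h
  linarith

/-- The recovery probability at a fixed sample size, given a bound `ε` on the probability that the
deletions cannot be repaired. -/
theorem sampleMeasure_real_recoveryEvent_ge_of_assumptionA [SecondCountableTopology X]
    (hX : IsGeodesicSpace X) (μ : Measure X) [IsProbabilityMeasure μ] {L ρ : ℝ}
    (hμ : IsDoublingMeasure μ L) {n : ℕ} (hn : 1 ≤ n) {r s τ c ε : ℝ} {p q : I} (hr : 0 < r)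
    (hτ : 0 < τ) (hA : AssumptionA μ n r s ρ) (hτs : τ ≤ s * n / 4) (hc0 : 0 < c)
    (hc : c ≤ 1 / (12 * (2 * (|L| * |ρ|) + 2)))
    (hq : (q : ℝ) ≤ c * (1 / (n : ℝ)) ^ (16 / τ) * (τ / (s * n))) (hε : 0 ≤ ε)
    (hdel : ∀ G : SimpleGraph (Fin n), EdgesInCliques G (s * n / 4) →
      (Measure.pi fun _ : Sym2 (Fin n) => bernoulliMeasure true false p).real
        (deletionFailure G τ) ≤ ε) :
    1 - (7 / n + ε) ≤ (sampleMeasure μ n p q).real (recoveryEvent X n r τ) := by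
  have hn0 : (0 : ℝ) < n := by exact_mod_cast hn
  obtain ⟨hA1, hA2⟩ := hA
  have hy : 13 * Real.log n ≤ s * n := by rwa [div_le_iff₀ hn0] at hA1
  have hs0 : 0 < s := by
    have : 0 < s * n := by linarith
    exact pos_of_mul_pos_left this hn0.le
  have hy0 : 0 < s * n := by positivity
  set A := |L| * |ρ| with hAdef
  have hA0 : 0 ≤ A := by positivity
  have hs1 : s ≤ 1 := by
    obtain ⟨x⟩ : Nonempty X := nonempty_of_isProbabilityMeasure μ
    exact (hA2 x).1.trans measureReal_le_one
  have hball : ∀ x, μ.real (Metric.closedBall x r) ≤ A * s := by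
    intro x
    refine (hμ.real_closedBall_le hr x (b := |ρ| * s) ((hA2 x).2.trans ?_)).trans (le_of_eq ?_)
    · gcongr
      exact le_abs_self ρ
    · rw [hAdef]; ring
  set C := 2 * A + 2 with hC
  set M := ⌊C * (s * n)⌋₊ with hM
  have hMle : (M : ℝ) ≤ C * (s * n) := Nat.floor_le (by positivity)
  set Q : SimpleGraph (Fin n) → Prop := fun G =>
    (∀ i, ((closedNbrs G i).card : ℝ) ≤ C * (s * n)) ∧ EdgesInCliques G (s * n / 4) with hQ
  have hpts : (Measure.pi fun _ : Fin n => μ).real {x | ¬ Q (geometricGraph r x)} ≤ 5 / (n : ℝ) := by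
    refine le_trans ?_ (points_bound_le hn hA0 hs1 hy)
    have h1 := pi_real_lt_card_closedNbrs_le μ (V := Fin n) r (A * s) (C * (s * n)) hball
    have h2 := pi_real_not_edgesInCliques_le hX μ (V := Fin n) r s (s * n / 4)
      (fun x => (hA2 x).1) hs0.le
    rw [Fintype.card_fin] at h1 h2
    refine (measureReal_mono ?_).trans ((measureReal_union_le _ _).trans (add_le_add h1 h2))
    intro x hx
    simp only [hQ, Set.mem_ofPred_eq, not_and_or, not_forall, not_le] at hx
    exact hx
  set k := max 2 ⌈τ⌉₊ with hk
  have hins : ∀ G, Q G →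
      (Measure.pi fun _ : Sym2 (Fin n) => bernoulliMeasure true false q).real
        (insertionFailure G k ((k + 3) / 4)) ≤ 2 / (n : ℝ) := by
    intro G hG
    refine (coin_real_insertionFailure_le q G (M := M) (l := (k * k + 3) / 4)
      (fun x => Nat.le_floor (hG.1 x)) (by omega)).trans ?_
    rw [Fintype.card_fin]
    exact insertion_bound_le hn hτ hk rfl rfl (by rw [hC]; linarith) hMle hτs hc0 hc q.2.1 hq
  have := sampleMeasure_real_recoveryEvent_ge μ (k := k) (j := (k + 3) / 4) (r := r) (τ := τ)
    (p := p) (q := q) Q hk (by omega) hpts (fun G hG => hdel G hG.2) hins hε (by positivity)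
  refine le_trans (le_of_eq ?_) this
  ring

theorem tendsto_one_of_real_ge {Ω : ℕ → Type*} [∀ n, MeasurableSpace (Ω n)]
    (μ : ∀ n, Measure (Ω n)) [∀ n, IsProbabilityMeasure (μ n)] (A : ∀ n, Set (Ω n)) (c : ℝ)
    (h : ∀ᶠ n in atTop, 1 - c / n ≤ (μ n).real (A n)) :
    Tendsto (fun n => μ n (A n)) atTop (𝓝 1) := by
  have hlim : Tendsto (fun n : ℕ => ENNReal.ofReal (1 - c / n)) atTop (𝓝 1) := by
    have h1 : Tendsto (fun n : ℕ => 1 - c / (n : ℝ)) atTop (𝓝 (1 - 0)) :=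
      tendsto_const_nhds.sub (tendsto_const_div_atTop_nhds_zero_nat c)
    rw [sub_zero] at h1
    simpa using ENNReal.tendsto_ofReal h1
  refine tendsto_of_tendsto_of_tendsto_of_le_of_le' hlim tendsto_const_nhds ?_
    (Eventually.of_forall fun n => prob_le_one)
  filter_upwards [h] with n hn
  exact ENNReal.ofReal_le_of_le_toReal hn

end Assembly

theorem mainTheorem3 :
    ∃ c₀ : ℝ, 0 < c₀ ∧ c₀ < 1 ∧
    ∀ (L ρ : ℝ) (β : ℕ), ∃ c₁ c₂ c₃ : ℝ, 0 < c₁ ∧ 0 < c₂ ∧ 0 < c₃ ∧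
    ∀ (X : Type*) [MetricSpace X] [CompactSpace X] [MeasurableSpace X] [BorelSpace X]
      (μ : Measure X) [IsProbabilityMeasure μ],
      IsGeodesicSpace X → IsDoublingMeasure μ L → besicovitchConst X = β →
    ∀ (r s τ : ℕ → ℝ) (q : ℕ → I),
      (∀ᶠ n in atTop, 0 < r n ∧ 0 < τ n ∧ AssumptionA μ n (r n) (s n) ρ) →
      -- constant deletion probability in `(0, c₀)`
      (∀ p : I, 0 < (p : ℝ) → (p : ℝ) < c₀ →
        (∀ᶠ n : ℕ in atTop, τ n ≤ 2 / 3 * Real.logb (1 / (1 - (p : ℝ))) (s n * n)) →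
        -- eventually the second term of the minimum is the minimum
        (∀ᶠ n : ℕ in atTop,
          c₂ * (1 / (n : ℝ)) ^ (c₃ / τ n) * (τ n / (s n * n * √(1 - (p : ℝ)))) =
            min c₁ (c₂ * (1 / (n : ℝ)) ^ (c₃ / τ n) * (τ n / (s n * n * √(1 - (p : ℝ)))))) ∧
        ((∀ᶠ n : ℕ in atTop,
          (q n : ℝ) ≤
            c₂ * (1 / (n : ℝ)) ^ (c₃ / τ n) * (τ n / (s n * n * √(1 - (p : ℝ))))) →
          Tendsto (fun n => sampleMeasure μ n p (q n) (recoveryEvent X n (r n) (τ n)))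
            atTop (𝓝 1))) ∧
      -- no deletion
      ((∀ᶠ n : ℕ in atTop, τ n < s n * n / 4) →
        (∀ᶠ n : ℕ in atTop,
          (q n : ℝ) ≤ min c₁ (c₂ * (1 / (n : ℝ)) ^ (c₃ / τ n) * (τ n / (s n * n)))) →
        Tendsto (fun n => sampleMeasure μ n 0 (q n) (recoveryEvent X n (r n) (τ n)))
          atTop (𝓝 1)) := by
  -- The constant `C` below is the degree bound in units of `s n`. The 24 is twice the 12 required
  -- by the insertion bound, leaving room for `1/√(1-p) ≤ 2`; `c₁ = 1` works because `τ ≤ s n / 4`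
  -- eventually.
  refine ⟨1 / 1000, by norm_num, by norm_num, fun L ρ β => ?_⟩
  set C : ℝ := 2 * (|L| * |ρ|) + 2 with hC
  have hC2 : 2 ≤ C := by rw [hC]; linarith [mul_nonneg (abs_nonneg L) (abs_nonneg ρ)]
  have hc2 : 1 / (24 * C) ≤ 1 := by rw [div_le_one (by positivity)]; linarith
  refine ⟨1, 1 / (24 * C), 16, one_pos, by positivity, by norm_num, ?_⟩
  intro X _ _ _ _ μ _ hX hμ _ r s τ q hA
  have hgrow : Tendsto (fun n : ℕ => s n * n) atTop atTop := by
    refine tendsto_atTop_mono' _ ?_ ((Real.tendsto_log_atTop.comp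
      tendsto_natCast_atTop_atTop).const_mul_atTop (show (0 : ℝ) < 13 by norm_num))
    filter_upwards [hA, eventually_ge_atTop 1] with n hn hn1
    have := hn.2.2.1
    rwa [div_le_iff₀ (by exact_mod_cast hn1)] at this
  refine ⟨fun p hp0 hp hτ => ?_, fun hτ hq => ?_⟩
  · have hpar := hgrow.eventually (exists_clique_parameters p hp0 hp)
    have hsqrt : 1 / 2 ≤ √(1 - (p : ℝ)) := by
      refine Real.le_sqrt_of_sq_le ?_
      norm_num
      linarith
    have hfactor : ∀ᶠ n : ℕ in atTop,
        1 / (24 * C) * (1 / (n : ℝ)) ^ (16 / τ n) * (τ n / (s n * n * √(1 - (p : ℝ)))) ≤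
          2 * (1 / (24 * C)) * (1 / (n : ℝ)) ^ (16 / τ n) * (τ n / (s n * n)) := by
      filter_upwards [hA, hgrow.eventually_gt_atTop 0] with n hn hy
      have hτ0 := hn.2.1
      calc _ ≤ 1 / (24 * C) * (1 / (n : ℝ)) ^ (16 / τ n) * (τ n / (s n * n * (1 / 2))) := by
            gcongr
        _ = _ := by field_simp
    refine ⟨?_, fun hq => ?_⟩
    · filter_upwards [hA, hτ, hpar, hfactor, hgrow.eventually_gt_atTop 0, eventually_ge_atTop 1]
        with n hn hτn hpn hfn hy hn1
      refine (min_eq_right (hfn.trans ?_)).symm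
      have hn1' : (1 : ℝ) ≤ n := by exact_mod_cast hn1
      have hτ0 := hn.2.1
      have h1 : (1 / (n : ℝ)) ^ (16 / τ n) ≤ 1 := by
        refine Real.rpow_le_one (by positivity) ?_ (by positivity)
        rw [div_le_one (by linarith)]
        exact hn1'
      have h2 : τ n / (s n * n) ≤ 1 / 4 := by
        rw [div_le_iff₀ hy]
        linarith [hpn.1]
      calc _ ≤ 2 * 1 * 1 * (1 / 4 : ℝ) := by gcongr
        _ ≤ 1 := by norm_num
    -- Here 107 is 5 for the points, 2 for the insertions and 100 for the deletions.
    · refine tendsto_one_of_real_ge _ _ 107 ?_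
      filter_upwards [hA, hτ, hpar, hfactor, hq, eventually_ge_atTop 1]
        with n hn hτn hpn hfn hqn hn1
      obtain ⟨hle, k, m, a, P, hk, hkge, hm, hka, hP, hbound⟩ := hpn
      have hy : 13 * Real.log n ≤ s n * n := by
        have := hn.2.2.1
        rwa [div_le_iff₀ (by exact_mod_cast hn1)] at this
      have hmain := sampleMeasure_real_recoveryEvent_ge_of_assumptionA hX μ hμ hn1 (p := p)
        (ε := 100 / n) hn.1 hn.2.1 hn.2.2 (hτn.trans hle) (c := 2 * (1 / (24 * C)))
        (by positivity) (by rw [hC]; apply le_of_eq; field_simp; norm_num) (hqn.trans hfn)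
        (by positivity) ?_
      · refine le_trans (le_of_eq ?_) hmain
        ring
      · intro G hG
        refine (coin_real_deletionFailure_le hG p (by linarith) hm hk (hτn.trans hkge) hka
          hP).trans ?_
        rw [Fintype.card_fin]
        calc _ ≤ (n : ℝ) ^ 2 * (100 * Real.exp (-(3 / 10 * (s n * n)))) := by gcongr
          _ = 100 * ((n : ℝ) ^ 2 * Real.exp (-(3 / 10 * (s n * n)))) := by ring
          _ ≤ 100 * (1 / (n : ℝ)) := by
            gcongr
            exact sq_mul_exp_le hn1 hy
          _ = 100 / (n : ℝ) := by ring
  · refine tendsto_one_of_real_ge _ _ 7 ?_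
    filter_upwards [hA, hτ, hq, eventually_ge_atTop 1] with n hn hτn hqn hn1
    have hmain := sampleMeasure_real_recoveryEvent_ge_of_assumptionA hX μ hμ hn1 (p := 0)
      (ε := 0) hn.1 hn.2.1 hn.2.2 hτn.le (c := 1 / (24 * C)) (by positivity)
      (by rw [hC]; gcongr; norm_num) (hqn.trans (min_le_right _ _)) le_rfl
      (fun G hG => (coin_zero_real_deletionFailure_eq_zero hG hτn.le).le)
    rwa [add_zero] at hmain
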